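/- Let $N$ be a finite nonempty set of $n$ agents and let the set of outcomes be $\mathbb{Z}$. A preference (complete transitive relation $R_i$ on $\mathbb{Z}$) is single peaked with ideal point $p$ if $y$ is strictly preferred to $z$ whenever $p\le y<z$ or $z<y\le p$. For $D\subseteq\mathbb{Z}$ let $\mathcal{R}_D$ be the set of all single-peaked preferences with ideal point in $D$; the domain of single-peaked preferences is $\mathcal{R}_{\mathbb{Z}}$. A social choice function on a domain $\mathcal R$ is a map $f:\mathcal{R}^N\to\mathbb{Z}$; it is unanimous if it chooses $p$ whenever all agents have ideal point $p$. It is OSP-implementable if there are an extensive-form mechanism (with information partitions; infinite histories are allowed and carry outcomes) and for each agent a strategy (a map from preferences to behaviors) that is obviously dominant, such that the induced outcome is always $f(R)$. A strategy of $i$ is obviously dominant if, at every information set of $i$ that can be reached when $i$ follows it, $i$ weakly prefers every outcome possible when following the strategy, from any history in the set, to every outcome possible after a deviation at that information set. A proto-dictatorship between $y$ and $z$ is a finite stream of distinct agents, each of whom in turn is offered one of the two options and either implements it or lets the stream go on, except that the last agent chooses between $y$ and $z$; each agent acts according to her preference between $y$ and $z$. A dictatorship with safeguards against extremism (with the possibility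 of arbitration) is a social choice function given by: a dictator $d\in N$; a center $y^m\in\mathbb{Z}$; bounds $l^i\in\mathbb{Z}\cup\{-\infty\}$ and $r^i\in\mathbb{Z}\cup\{\infty\}$ with $l^i\le y^m\le r^i$ for each $i\ne d$; for each $y>y^m$ possibly an arbitrator $i\neq d$ with $r^i=y$ and a proto-dictatorship between $y-1$ and $y$; and for each $y<y^m$ possibly an arbitrator $i\ne d$ with $l^i=y$ and a proto-dictatorship between $y+1$ and $y$. Its outcome at $R$ is determined as follows. Let $\underline{y}^i$ and $\overline{y}^i$ be agent $i$'s most preferred policies in $(-\infty,l^i]$ and $[r^i,\infty)$ (with $\underline y^i=-\infty$ if $l^i=-\infty$, and $\overline y^i=\infty$ if $r^i=\infty$), and let $b$ be $d$'s most preferred policy in $\bigcap_{i\ne d}[\underline{y}^i,\overline{y}^i]$. If there is an arbitrator at $b$ and she strictly prefers the adjacent policy on the side of the center ($b-1$ if $b>y^m$, $b+1$ if $b<y^m$) to $b$, then the outcome is that of the associated proto-dictatorship; otherwise it is $b$. **Theorem.** 1. A social choice function on the domain of single-peaked preferences is unanimous and OSP-implementable if and only if it is a dictatorship with safeguards against extremism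 (with the possibility of arbitration). Any such function is Pareto optimal. 2. Let $D\subseteq\mathbb{Z}$ have at least two elements. If $n\ge3$, then no social choice function on $\mathcal{R}_D$ that always chooses a median of the ideal points is OSP-implementable. If, for some $1\le k\le n$, the rule on $\mathcal{R}_D$ that chooses the $k$-th smallest ideal point is OSP-implementable, then $k=1$ or $k=n$. 3. Conversely, the rule on $\mathcal{R}_D$ that chooses the minimal ideal point is OSP-implementable if $D$ is bounded below, and the rule that chooses the maximal ideal point is OSP-implementable if $D$ is bounded above. -/

import Mathlib

section Preferences

/-- A preference: a complete and transitive relation; `R.rel x y` reads "`x` is weakly preferred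
to `y`". -/
@[ext]
structure Pref (Y : Type) where
  rel : Y → Y → Prop
  total : ∀ x y, rel x y ∨ rel y x
  trans : ∀ x y z, rel x y → rel y z → rel x z

/-- Strict preference. -/
def Pref.strict {Y : Type} (R : Pref Y) (x y : Y) : Prop := R.rel x y ∧ ¬ R.rel y x

/-- `y` is a most preferred element of `S`. -/
def Pref.IsBest {Y : Type} (R : Pref Y) (S : Set Y) (y : Y) : Prop :=
  y ∈ S ∧ ∀ z ∈ S, R.rel y z

/-- `R` is single peaked with ideal point `p`: on either side of `p`, closer policies are strictly
better.  Policies on different sides of `p` are compared arbitrarily (ties allowed). -/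
def Pref.IsIdeal (R : Pref ℤ) (p : ℤ) : Prop :=
  (∀ y z, p ≤ y → y < z → R.strict y z) ∧ (∀ y z, z < y → y ≤ p → R.strict y z)

/-- All single peaked preferences on `ℤ` whose ideal point lies in `D`. The domain of single peaked
preferences is `singlePeaked Set.univ`. -/
def singlePeaked (D : Set ℤ) : Set (Pref ℤ) := {R | ∃ p ∈ D, R.IsIdeal p}

/-- Social choice functions for agents `N`, each with preference domain `ℛ`. -/
abbrev SCF (N : Type) {Y : Type} (ℛ : Set (Pref Y)) : Type := (N → ℛ) → Y

/-- If all ideal points coincide, the common ideal point is chosen. -/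
def Unanimous {N : Type} {ℛ : Set (Pref ℤ)} (f : SCF N ℛ) : Prop :=
  ∀ (R : N → ℛ) (p : ℤ), (∀ i, (R i : Pref ℤ).IsIdeal p) → f R = p

def ParetoOptimal {N Y : Type} {ℛ : Set (Pref Y)} (f : SCF N ℛ) : Prop :=
  ∀ R : N → ℛ, ¬ ∃ y, (∀ i, (R i : Pref Y).rel y (f R)) ∧ ∃ i, (R i : Pref Y).strict y (f R)

end Preferences

/-- A (deterministic) mechanism: an extensive game form with possibly infinite histories.
Finite histories are lists of actions, the earliest action first; infinite histories are the
infinite sequences of actions all of whose finite initial segments are histories.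
`player` matters at nonterminal histories only, `outcome` at finite terminal ones,
`limitOutcome` at infinite ones.  The classes of `info`, restricted to nonterminal histories,
are the cells of the information partitions of all players. -/
structure Mechanism (N Y : Type) where
  Act : Type
  hist : Set (List Act)
  nil_mem : [] ∈ hist
  init_mem : ∀ h a, h ++ [a] ∈ hist → h ∈ hist
  player : List Act → N
  info : Setoid (List Act)
  info_player : ∀ h h', (∃ a, h ++ [a] ∈ hist) → (∃ a, h' ++ [a] ∈ hist) → info.r h h' →
    player h = player h'
  info_actions : ∀ h h', (∃ a, h ++ [a] ∈ hist) → (∃ a, h' ++ [a] ∈ hist) → info.r h h' →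
    ∀ a, h ++ [a] ∈ hist ↔ h' ++ [a] ∈ hist
  outcome : List Act → Y
  limitOutcome : (ℕ → Act) → Y

namespace Mechanism

variable {N Y : Type} (M : Mechanism N Y)

/-- The actions available after `h`. -/
def actions (h : List M.Act) : Set M.Act := {a | h ++ [a] ∈ M.hist}

/-- `h` is a nonterminal history. -/
def Nonterminal (h : List M.Act) : Prop := (M.actions h).Nonempty

/-- A behavior of player `i`: an available action at each nonterminal history where `i` moves,
the same one throughout each information set.  Values elsewhere are irrelevant. -/
structure Behavior (i : N) where
  act : List M.Act → M.Act
  mem : ∀ h, M.Nonterminal h → M.player h = i → act h ∈ M.actions h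
  measurable : ∀ h h', M.Nonterminal h → M.Nonterminal h' → M.player h = i → M.player h' = i →
    M.info.r h h' → act h = act h'

variable {M}

/-- The action taken at `h` under the behavior profile `B`. -/
def next (B : ∀ i, M.Behavior i) (h : List M.Act) : M.Act := (B (M.player h)).act h

open Classical in
/-- The finite history reached after `k` moves (or the terminal one where the game has ended). -/
noncomputable def play (B : ∀ i, M.Behavior i) : ℕ → List M.Act
  | 0 => []
  | k + 1 => if M.Nonterminal (play B k) then play B k ++ [next B (play B k)] else play B k

/-- The finite histories on the path of the behavior profile `B`. -/
def path (B : ∀ i, M.Behavior i) : Set (List M.Act) := Set.range (play B)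

open Classical in
/-- The outcome that the mechanism assigns to the behavior profile `B`. -/
noncomputable def result (B : ∀ i, M.Behavior i) : Y :=
  if h : ∃ k, ¬ M.Nonterminal (play B k) then M.outcome (play B (Nat.find h))
  else M.limitOutcome fun k => next B (play B k)

open Classical in
/-- The strategy `S` of player `i` is obviously dominant. -/
def ObviouslyDominant {ℛ : Set (Pref Y)} (i : N) (S : ℛ → M.Behavior i) : Prop :=
  ∀ (R : ℛ) (B B' : ∀ j, M.Behavior j) (h h' : List M.Act),
    M.Nonterminal h → M.Nonterminal h' →
    h ∈ path (Function.update B i (S R)) → h' ∈ path B' →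
    M.player h = i → M.player h' = i → M.info.r h h' →
    (S R).act h ≠ (B' i).act h' →
    (R : Pref Y).rel (result (Function.update B i (S R))) (result B')

end Mechanism

/-- `f` is implementable in obviously dominant strategies. -/
def OSPImplementable {N Y : Type} {ℛ : Set (Pref Y)} (f : SCF N ℛ) : Prop :=
  ∃ (M : Mechanism N Y) (S : ∀ i : N, ℛ → M.Behavior i),
    (∀ i, M.ObviouslyDominant i (S i)) ∧
    ∀ R : N → ℛ, Mechanism.result (fun i => S i (R i)) = f R

/-- A proto-dictatorship between two options `y` and `z`: a stream of agents, each of whom is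
offered either `y` (`true`) or `z` (`false`) and may implement it or let the stream go on; the last
agent chooses between `y` and `z`. -/
inductive ProtoDictatorship (N : Type) where
  | last (i : N) : ProtoDictatorship N
  | offer (i : N) (b : Bool) (rest : ProtoDictatorship N) : ProtoDictatorship N

namespace ProtoDictatorship

variable {N : Type}

/-- The agents in the stream, in order. -/
def agents : ProtoDictatorship N → List N
  | last i => [i]
  | offer i _ rest => i :: rest.agents

open Classical in
/-- The outcome of the proto-dictatorship between `y` and `z`, which no agent is indifferent
between. -/
noncomputable def result {Y : Type} (R : N → Pref Y) (y z : Y) : ProtoDictatorship N → Y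
  | last i => if (R i).strict y z then y else z
  | offer i true rest => if (R i).strict y z then y else rest.result R y z
  | offer i false rest => if (R i).strict z y then z else rest.result R y z

end ProtoDictatorship

/-- The parameters of a dictatorship with safeguards against extremism.  Agent `i ≠ dictator` may
block policies to the left of `left i` and to the right of `right i`.  When the mechanism moves to
the right from `y - 1` to `y`, one agent with `right i = y` may, besides forcing `y` or continuing,
call for arbitration between `y - 1` and `y` through a proto-dictatorship: `arbRight y` holds this
agent and the proto-dictatorship, if any.  Likewise `arbLeft y`, when the mechanism moves to the
left from `y + 1` to `y`. -/
structure SafeguardedDictatorship (N : Type) where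
  dictator : N
  left : N → WithBot ℤ
  right : N → WithTop ℤ
  center : ℤ
  left_le : ∀ i, i ≠ dictator → left i ≤ (center : WithBot ℤ)
  le_right : ∀ i, i ≠ dictator → (center : WithTop ℤ) ≤ right i
  arbRight : ℤ → Option (N × ProtoDictatorship N)
  arbLeft : ℤ → Option (N × ProtoDictatorship N)
  arbRight_spec : ∀ y i π, arbRight y = some (i, π) →
    center < y ∧ i ≠ dictator ∧ right i = (y : WithTop ℤ) ∧ π.agents.Nodup
  arbLeft_spec : ∀ y i π, arbLeft y = some (i, π) →
    y < center ∧ i ≠ dictator ∧ left i = (y : WithBot ℤ) ∧ π.agents.Nodup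

namespace SafeguardedDictatorship

variable {N : Type}

/-- The policies that no agent blocks: those between agent `i`'s preferred policy in
`(-∞, left i]` and her preferred policy in `[right i, ∞)`, for every `i` other than the dictator.
There is no lower bound if `left i = -∞`, no upper bound if `right i = ∞`. -/
def approved (s : SafeguardedDictatorship N) (R : N → Pref ℤ) : Set ℤ :=
  {y | ∀ i, i ≠ s.dictator →
    (∀ k : ℤ, s.left i = (k : WithBot ℤ) → ∀ z, (R i).IsBest (Set.Iic k) z → z ≤ y) ∧
    (∀ k : ℤ, s.right i = (k : WithTop ℤ) → ∀ z, (R i).IsBest (Set.Ici k) z → y ≤ z)}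

open Classical in
/-- The final outcome where the process stops at the policy `b`: the agent who may call for
arbitration at `b` does so if and only if she prefers the preceding policy to `b`. -/
noncomputable def arbitrate (s : SafeguardedDictatorship N) (R : N → Pref ℤ) (b : ℤ) : ℤ :=
  match s.arbRight b, s.arbLeft b with
  | some (i, π), _ => if (R i).strict (b - 1) b then π.result R (b - 1) b else b
  | none, some (i, π) => if (R i).strict (b + 1) b then π.result R (b + 1) b else b
  | none, none => b

/-- `f` is the social choice function with these parameters: the dictator's most preferred approved
policy, up to arbitration with a neighboring policy. -/
def Represents (s : SafeguardedDictatorship N) {ℛ : Set (Pref ℤ)} (f : SCF N ℛ) : Prop :=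
  ∀ R : N → ℛ, ∃ b : ℤ,
    (R s.dictator : Pref ℤ).IsBest (s.approved fun i => (R i : Pref ℤ)) b ∧
    f R = s.arbitrate (fun i => (R i : Pref ℤ)) b

end SafeguardedDictatorship

/-- `f` is a dictatorship with safeguards against extremism, with the possibility of arbitration. -/
def IsDictatorshipWithSafeguards {N : Type} {ℛ : Set (Pref ℤ)} (f : SCF N ℛ) : Prop :=
  ∃ s : SafeguardedDictatorship N, s.Represents f

section Quantiles

variable {N : Type} [Fintype N] {ℛ : Set (Pref ℤ)}

/-- `f` chooses the `k`-th smallest ideal point (`1 ≤ k ≤ n`): `k = 1` is the minimum,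
`k = n` the maximum. -/
def IsQuantileRule (k : ℕ) (f : SCF N ℛ) : Prop :=
  ∀ (R : N → ℛ) (p : N → ℤ), (∀ i, (R i : Pref ℤ).IsIdeal (p i)) →
    (Finset.univ.filter fun i => p i < f R).card < k ∧
    k ≤ (Finset.univ.filter fun i => p i ≤ f R).card

/-- `f` always chooses a median of the ideal points: at most half of them lie strictly on either
side. -/
def IsMedianRule (f : SCF N ℛ) : Prop :=
  ∀ (R : N → ℛ) (p : N → ℤ), (∀ i, (R i : Pref ℤ).IsIdeal (p i)) →
    2 * (Finset.univ.filter fun i => p i < f R).card ≤ Fintype.card N ∧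
    2 * (Finset.univ.filter fun i => f R < p i).card ≤ Fintype.card N

end Quantiles

/-! Necessity rests on one consequence of obvious dominance, `OSPImplementable.exists_obvious_pair`.
Restrict every agent to some set of preferences. If the choice is still not constant, there is a
first decision node at which plays of the remaining profiles part. Its player has two preferences
that act differently there, and obvious dominance compares every outcome under the one with every
outcome under the other, whatever the others do. Together with strategyproofness, this shows that a
unanimous rule depends on ideal points only, and turns it into an `IsObviousCutRule` `F`.

The rest of necessity is combinatorial. On the full domain, the obvious pair yields the dictator,
and a value separating the outcomes at her two ideal points becomes the center. To the right of the
center, an agent who can keep the choice from exceeding `t` can do so for every larger cut, so each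
agent has a threshold. On the profiles where nobody entitled to block at `t` does so, the obvious
pair shows that the choice exceeds `t`, unless one agent with threshold exactly `t + 1` has ideal
point at most `t` and a proto-dictatorship decides for `t` (`exists_arbitrator`). Reflection gives
the left side.

For sufficiency, the dictator picks a side and the policy then moves outward step by step. At each
distance an arbitrator may call for the proto-dictatorship, every agent entitled to block may stop,
and so may the dictator. An agent who rightly goes on will end between the current distance and her
ideal one, and the deviation gives nothing better; one who rightly stops loses nothing, since going
on leads only outward. Unending plays get an outcome beyond all finite thresholds, so that they obey
this too.

Unanimity and Pareto optimality hold because the outcome lies between two ideal points. Medians and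
interior order statistics fail on profiles with two preferences, where a lone dissenter never
matters. Minimum and maximum are safeguarded dictatorships centered at a bound of `D`. -/

/-! ### Single-peaked preferences -/

namespace Pref

theorem rel_refl {Y : Type} (R : Pref Y) (x : Y) : R.rel x x := (R.total x x).elim id id

variable {R : Pref ℤ} {p x y z : ℤ}

theorem IsIdeal.rel_right (h : R.IsIdeal p) (hy : p ≤ y) (hz : y ≤ z) : R.rel y z := by
  rcases hz.eq_or_lt with rfl | hz
  · exact R.rel_refl _
  · exact (h.1 y z hy hz).1

theorem IsIdeal.rel_left (h : R.IsIdeal p) (hz : z ≤ y) (hy : y ≤ p) : R.rel y z := by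
  rcases hz.eq_or_lt with rfl | hz
  · exact R.rel_refl _
  · exact (h.2 y z hz hy).1

theorem IsIdeal.rel_ideal (h : R.IsIdeal p) (z : ℤ) : R.rel p z :=
  (le_total p z).elim (fun hz => h.rel_right le_rfl hz) fun hz => h.rel_left hz le_rfl

theorem IsIdeal.le_of_rel (h : R.IsIdeal p) (hy : p ≤ y) (hxy : R.rel x y) : x ≤ y := by
  by_contra! hlt
  exact (h.1 y x hy hlt).2 hxy

theorem IsIdeal.ge_of_rel (h : R.IsIdeal p) (hy : y ≤ p) (hxy : R.rel x y) : y ≤ x := by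
  by_contra! hlt
  exact (h.2 y x hlt hy).2 hxy

theorem IsIdeal.eq_of_rel (h : R.IsIdeal p) (hxp : R.rel x p) : x = p :=
  le_antisymm (h.le_of_rel le_rfl hxp) (h.ge_of_rel le_rfl hxp)

theorem IsIdeal.strict_pred_iff (h : R.IsIdeal p) : R.strict (y - 1) y ↔ p ≤ y - 1 := by
  constructor
  · intro hs
    by_contra! hlt
    exact (h.2 y (y - 1) (by omega) (by omega)).2 hs.1
  · exact fun hp => h.1 _ _ hp (by omega)

theorem IsIdeal.strict_succ_iff (h : R.IsIdeal p) : R.strict (y + 1) y ↔ y + 1 ≤ p := by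
  constructor
  · intro hs
    by_contra! hlt
    exact (h.1 y (y + 1) (by omega) (by omega)).2 hs.1
  · exact fun hp => h.2 _ _ (by omega) hp

theorem IsIdeal.isBest_Ici_iff (h : R.IsIdeal p) : R.IsBest (Set.Ici x) z ↔ z = max x p := by
  constructor
  · rintro ⟨hz, hb⟩
    have hz' : x ≤ z := hz
    have h1 := hb (max x p) (le_max_left x p)
    have h2 := h.le_of_rel (le_max_right x p) h1
    rcases le_total p x with hpx | hpx
    · rw [max_eq_left hpx] at *; omega
    · rw [max_eq_right hpx] at *; exact h.eq_of_rel h1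
  · rintro rfl
    refine ⟨le_max_left x p, fun z hz => ?_⟩
    rcases le_total p x with hpx | hpx
    · rw [max_eq_left hpx]; exact h.rel_right hpx hz
    · rw [max_eq_right hpx]; exact h.rel_ideal z

theorem IsIdeal.isBest_Iic_iff (h : R.IsIdeal p) : R.IsBest (Set.Iic x) z ↔ z = min x p := by
  constructor
  · rintro ⟨hz, hb⟩
    have hz' : z ≤ x := hz
    have h1 := hb (min x p) (min_le_left x p)
    have h2 := h.ge_of_rel (min_le_right x p) h1
    rcases le_total x p with hpx | hpx
    · rw [min_eq_left hpx] at *; omega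
    · rw [min_eq_right hpx] at *; exact h.eq_of_rel h1
  · rintro rfl
    refine ⟨min_le_left x p, fun z hz => ?_⟩
    rcases le_total x p with hpx | hpx
    · rw [min_eq_left hpx]; exact h.rel_left hz hpx
    · rw [min_eq_right hpx]; exact h.rel_ideal z

/-- The single peaked preference with ideal point `p` that ranks everything on the right of `p`
above everything on the left. -/
def rightLexi (p : ℤ) : Pref ℤ where
  rel x y := (p ≤ x ∧ (y < p ∨ x ≤ y)) ∨ (x < p ∧ y ≤ x)
  total := by intros; omega
  trans := by intros; omega

/-- The single peaked preference with ideal point `p` that ranks everything on the left of `p`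
above everything on the right. -/
def leftLexi (p : ℤ) : Pref ℤ where
  rel x y := (x ≤ p ∧ (p < y ∨ y ≤ x)) ∨ (p < x ∧ x ≤ y)
  total := by intros; omega
  trans := by intros; omega

theorem isIdeal_rightLexi (p : ℤ) : (rightLexi p).IsIdeal p := by
  constructor <;> intro y z h1 h2 <;> simp only [strict, rightLexi] <;> omega

theorem isIdeal_leftLexi (p : ℤ) : (leftLexi p).IsIdeal p := by
  constructor <;> intro y z h1 h2 <;> simp only [strict, leftLexi] <;> omega

end Pref

/-! ### Consequences of obvious dominance -/

namespace Mechanism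

variable {N Y : Type} {M : Mechanism N Y}

theorem play_succ_of_nonterminal {B : ∀ i, M.Behavior i} {k : ℕ} (h : M.Nonterminal (play B k)) :
    play B (k + 1) = play B k ++ [next B (play B k)] := by
  rw [play, if_pos h]

theorem play_succ_of_terminal {B : ∀ i, M.Behavior i} {k : ℕ} (h : ¬ M.Nonterminal (play B k)) :
    play B (k + 1) = play B k := by
  rw [play, if_neg h]

/-- Actions can be read off consecutive histories, so even the outcome of an infinite play is
determined by its finite histories. Hence different results show at a finite stage. -/
theorem result_congr {B B' : ∀ i, M.Behavior i} (h : ∀ k, play B k = play B' k) :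
    result B = result B' := by
  classical
  by_cases hB : ∃ k, ¬ M.Nonterminal (play B k)
  · have hB' : ∃ k, ¬ M.Nonterminal (play B' k) := by simpa only [h] using hB
    have hf : Nat.find hB = Nat.find hB' := by simp only [h]
    rw [result, result, dif_pos hB, dif_pos hB', h, hf]
  · have hB' : ¬ ∃ k, ¬ M.Nonterminal (play B' k) := by simpa only [h] using hB
    rw [result, result, dif_neg hB, dif_neg hB']
    push Not at hB hB'
    congr 1
    funext k
    have hk := h (k + 1)
    rw [play_succ_of_nonterminal (hB k), play_succ_of_nonterminal (hB' k), h k] at hk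
    simpa [h k] using hk

end Mechanism

/-- On every product of sets of preferences on which `f` is not constant, some agent has two
preferences that are never worse served by telling them apart, whatever the other agents do in
either case. -/
theorem OSPImplementable.exists_obvious_pair {N Y : Type} {ℛ : Set (Pref Y)} {f : SCF N ℛ}
    (hf : OSPImplementable f) (T : N → Set ℛ)
    (hT : ∃ Q Q', (∀ i, Q i ∈ T i) ∧ (∀ i, Q' i ∈ T i) ∧ f Q ≠ f Q') :
    ∃ i, ∃ a ∈ T i, ∃ b ∈ T i, a ≠ b ∧ ∀ Q Q', (∀ j, Q j ∈ T j) → (∀ j, Q' j ∈ T j) →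
      Q i = a → Q' i = b → (a : Pref Y).rel (f Q) (f Q') ∧ (b : Pref Y).rel (f Q') (f Q) := by
  classical
  obtain ⟨M, S, hS, hres⟩ := hf
  let P : (N → ℛ) → ℕ → List M.Act := fun Q => Mechanism.play fun i => S i (Q i)
  -- Take the first stage at which two profiles of the product part. One stage earlier all of them
  -- are at the same history `h`, so its player faces both preferences at one and the same node.
  have hex : ∃ k, ∃ Q Q', (∀ i, Q i ∈ T i) ∧ (∀ i, Q' i ∈ T i) ∧ P Q k ≠ P Q' k := by
    obtain ⟨Q, Q', hQ, hQ', hne⟩ := hT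
    by_contra! hall
    exact hne (by rw [← hres Q, ← hres Q']
                  exact Mechanism.result_congr fun k => hall k Q Q' hQ hQ')
  obtain ⟨Q₀, Q₁, hQ₀, hQ₁, hne⟩ := Nat.find_spec hex
  have hmin := fun k hk => Nat.find_min hex (m := k) hk
  push Not at hmin
  rcases hk : Nat.find hex with _ | k
  · rw [hk] at hne
    exact absurd rfl hne
  rw [hk] at hne hmin
  replace hmin := hmin k k.lt_succ_self
  set h := P Q₀ k with hdef
  have hP : ∀ Q, (∀ i, Q i ∈ T i) → P Q k = h := fun Q hQ => hmin Q Q₀ hQ hQ₀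
  have hnt : M.Nonterminal h := by
    by_contra hn
    apply hne
    change Mechanism.play _ _ = Mechanism.play _ _
    rw [Mechanism.play_succ_of_terminal hn, Mechanism.play_succ_of_terminal]
    · exact (hP Q₁ hQ₁).symm
    · change ¬ M.Nonterminal (P Q₁ k)
      rwa [hP Q₁ hQ₁]
  have hact : (S (M.player h) (Q₀ (M.player h))).act h ≠ (S (M.player h) (Q₁ (M.player h))).act h := by
    intro he
    apply hne
    have h1 : Mechanism.play (fun i => S i (Q₁ i)) k = h := hP Q₁ hQ₁
    change Mechanism.play _ _ = Mechanism.play _ _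
    rw [Mechanism.play_succ_of_nonterminal hnt, Mechanism.play_succ_of_nonterminal (by rwa [h1]), h1]
    change h ++ [_] = _
    rw [List.append_cancel_left_eq, List.cons.injEq]
    exact ⟨he, rfl⟩
  have key : ∀ Q Q', (∀ j, Q j ∈ T j) → (∀ j, Q' j ∈ T j) →
      (S (M.player h) (Q (M.player h))).act h ≠ (S (M.player h) (Q' (M.player h))).act h →
      (Q (M.player h) : Pref Y).rel (f Q) (f Q') := by
    intro Q Q' hQ hQ' hd
    have := hS (M.player h) (Q (M.player h)) (fun i => S i (Q i)) (fun i => S i (Q' i)) h h hnt hnt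
    rw [Function.update_eq_self, hres, hres] at this
    exact this ⟨k, hP Q hQ⟩ ⟨k, hP Q' hQ'⟩ rfl rfl (M.info.refl h) hd
  refine ⟨M.player h, _, hQ₀ _, _, hQ₁ _, fun he => hact (by rw [he]), ?_⟩
  intro Q Q' hQ hQ' h0 h1
  have a := key Q Q' hQ hQ' (by rw [h0, h1]; exact hact)
  have b := key Q' Q hQ' hQ (by rw [h0, h1]; exact hact.symm)
  rw [h0] at a
  rw [h1] at b
  exact ⟨a, b⟩

/-- No agent gains by misrepresenting her preference. -/
theorem OSPImplementable.strategyproof {N Y : Type} {ℛ : Set (Pref Y)} {f : SCF N ℛ}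
    (hf : OSPImplementable f) (i : N) {Q Q' : N → ℛ} (h : ∀ j, j ≠ i → Q' j = Q j) :
    (Q i : Pref Y).rel (f Q) (f Q') := by
  classical
  by_cases hne : f Q = f Q'
  · rw [hne]; exact Pref.rel_refl _ _
  have hmem : ∀ j, Q' j ∈ ({Q j, Q' j} : Set ℛ) := fun j => Or.inr rfl
  have hmem' : ∀ j, Q j ∈ ({Q j, Q' j} : Set ℛ) := fun j => Or.inl rfl
  -- All factors other than the `i`-th are singletons, so the agent with two distinct preferences
  -- must be `i`.
  obtain ⟨j, a, ha, b, hb, hab, hr⟩ :=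
    hf.exists_obvious_pair (fun j => {Q j, Q' j}) ⟨Q, Q', hmem', hmem, hne⟩
  have hj : j = i := by
    by_contra hji
    have e := h j hji
    simp only [e, Set.mem_insert_iff, Set.mem_singleton_iff, or_self] at ha hb
    exact hab (ha.trans hb.symm)
  subst hj
  rcases ha with rfl | rfl <;> rcases hb with rfl | rfl
  · exact absurd rfl hab
  · exact (hr Q Q' hmem' hmem rfl rfl).1
  · exact (hr Q' Q hmem hmem' rfl rfl).2
  · exact absurd rfl hab

/-- A binary choice in which no single agent can secure either of the two options is not
implementable in obviously dominant strategies. -/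
theorem not_ospImplementable_of_no_binary_power {N : Type} {ℛ : Set (Pref ℤ)} {f : SCF N ℛ}
    [Nonempty N] {x y : ℤ} (hxy : x ≠ y) (A B : ℛ) (hA : (A : Pref ℤ).IsIdeal x)
    (hB : (B : Pref ℤ).IsIdeal y)
    (h₁ : ∀ (Q : N → ℛ) i, Q i = A → (∀ j, j ≠ i → Q j = B) → f Q = y)
    (h₂ : ∀ (Q : N → ℛ) i, Q i = B → (∀ j, j ≠ i → Q j = A) → f Q = x) :
    ¬ OSPImplementable f := by
  classical
  intro hf
  have m₁ : ∀ i j, Function.update (fun _ : N => B) i A j ∈ ({A, B} : Set ℛ) := by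
    intro i j
    by_cases h : j = i
    · subst h; simp
    · simp [h]
  have m₂ : ∀ i j, Function.update (fun _ : N => A) i B j ∈ ({A, B} : Set ℛ) := by
    intro i j
    by_cases h : j = i
    · subst h; simp
    · simp [h]
  have e₁ : ∀ i, f (Function.update (fun _ => B) i A) = y := fun i =>
    h₁ _ i (by simp) fun j hj => by simp [hj]
  have e₂ : ∀ i, f (Function.update (fun _ => A) i B) = x := fun i =>
    h₂ _ i (by simp) fun j hj => by simp [hj]
  obtain ⟨i₀⟩ := ‹Nonempty N›
  obtain ⟨i, a, ha, b, hb, hab, hr⟩ := hf.exists_obvious_pair (fun _ => {A, B})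
    ⟨_, _, m₁ i₀, m₂ i₀, by rw [e₁, e₂]; exact hxy.symm⟩
  -- Compare the profile where `i` alone has `A` with the one where she alone has `B`: with
  -- preference `A` she would have to like `y` as much as her ideal `x`.
  have key : (A : Pref ℤ).rel y x := by
    rcases ha with rfl | rfl <;> rcases hb with rfl | rfl
    · exact absurd rfl hab
    · have := (hr _ _ (m₁ i) (m₂ i) (by simp) (by simp)).1
      rwa [e₁, e₂] at this
    · have := (hr _ _ (m₂ i) (m₁ i) (by simp) (by simp)).2
      rwa [e₁, e₂] at this
    · exact absurd rfl hab
  exact hxy (hA.eq_of_rel key).symm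

/-- A function of profiles that weakly increases whenever one coordinate is replaced weakly
increases along any simultaneous replacement. -/
theorem le_of_forall_update {N α β : Type} [Finite N] [Preorder β] [DecidableEq N]
    {r : N → α → α → Prop} {g : (N → α) → β}
    (h : ∀ i R a, r i (R i) a → g R ≤ g (Function.update R i a)) {R R' : N → α}
    (hr : ∀ i, r i (R i) (R' i)) : g R ≤ g R' := by
  classical
  cases nonempty_fintype N
  have : ∀ s : Finset N, g R ≤ g (s.piecewise R' R) := by
    intro s
    induction s using Finset.induction_on with
    | empty => simp
    | insert i s hi ih =>
      refine ih.trans ?_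
      rw [Finset.piecewise_insert]
      apply h
      rw [Finset.piecewise_eq_of_notMem _ _ _ hi]
      exact hr i
  simpa using this Finset.univ

/-! ### Dependence on ideal points only -/

section TopsOnly

variable {N : Type} {f : SCF N (singlePeaked Set.univ)}

/-- Let `i` have her two preferences and every other `j` either `Q j` or a preference `C` with ideal
point `p`. When all others have `C`, unanimity gives `p`. If the obvious pair belongs to `i`, both
outcomes are as good as `p` for her, hence equal to `p`. If it belongs to another agent, both
outcomes lie on her side of `p`; there the two preferences of `i` agree and are strict, so
strategyproofness makes the outcomes equal. -/
theorem OSPImplementable.eq_of_same_ideal_update (hf : OSPImplementable f) (hu : Unanimous f)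
    (i : N) {Q Q' : N → singlePeaked Set.univ} (h : ∀ j, j ≠ i → Q' j = Q j) {p : ℤ}
    (hp : (Q i : Pref ℤ).IsIdeal p) (hp' : (Q' i : Pref ℤ).IsIdeal p) : f Q = f Q' := by
  classical
  by_contra hne
  let C : singlePeaked Set.univ := ⟨Pref.rightLexi p, p, trivial, Pref.isIdeal_rightLexi p⟩
  have hC : (C : Pref ℤ).IsIdeal p := Pref.isIdeal_rightLexi p
  let T : N → Set (singlePeaked Set.univ) := fun j => if j = i then {Q i, Q' i} else {Q j, C}
  have hTi : T i = {Q i, Q' i} := if_pos rfl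
  have hTj : ∀ j, j ≠ i → T j = {Q j, C} := fun j hj => if_neg hj
  have hQ : ∀ j, Q j ∈ T j := by
    intro j
    by_cases hj : j = i
    · subst hj; rw [hTi]; simp
    · rw [hTj j hj]; simp
  have hQ' : ∀ j, Q' j ∈ T j := by
    intro j
    by_cases hj : j = i
    · subst hj; rw [hTi]; simp
    · rw [hTj j hj, h j hj]; simp
  have hQC : ∀ a ∈ T i, ∀ j, Function.update (fun _ => C) i a j ∈ T j := by
    intro a ha j
    by_cases hj : j = i
    · subst hj; simpa using ha
    · rw [hTj j hj]; simp [hj]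
  have hval : ∀ a ∈ T i, f (Function.update (fun _ => C) i a) = p := by
    intro a ha
    apply hu
    intro j
    by_cases hj : j = i
    · subst hj
      rw [hTi] at ha
      rcases ha with rfl | rfl <;> simpa
    · simpa [hj] using hC
  obtain ⟨j, a, ha, b, hb, hab, hr⟩ := hf.exists_obvious_pair T ⟨Q, Q', hQ, hQ', hne⟩
  have hs := hf.strategyproof i h
  have hs' := hf.strategyproof i (Q := Q') (Q' := Q) fun j hj => (h j hj).symm
  by_cases hj : j = i
  · subst hj
    have h1 : (Q j : Pref ℤ).rel (f Q) p ∧ (Q' j : Pref ℤ).rel (f Q') p := by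
      have ha' := ha
      have hb' := hb
      rw [hTi] at ha' hb'
      rcases ha' with rfl | rfl <;> rcases hb' with rfl | rfl
      · exact absurd rfl hab
      · have h1 := (hr Q _ hQ (hQC _ hb) rfl (by simp)).1
        have h2 := (hr _ Q' (hQC _ ha) hQ' (by simp) rfl).2
        rw [hval _ hb] at h1
        rw [hval _ ha] at h2
        exact ⟨h1, h2⟩
      · have h1 := (hr _ Q (hQC _ ha) hQ (by simp) rfl).2
        have h2 := (hr Q' _ hQ' (hQC _ hb) rfl (by simp)).1
        rw [hval _ ha] at h1
        rw [hval _ hb] at h2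
        exact ⟨h1, h2⟩
      · exact absurd rfl hab
    exact hne ((hp.eq_of_rel h1.1).trans (hp'.eq_of_rel h1.2).symm)
  · have h1 : (Q j : Pref ℤ).rel (f Q) p ∧ (Q j : Pref ℤ).rel (f Q') p := by
      have hQi : Q i ∈ T i := hQ i
      have ha' := ha
      have hb' := hb
      rw [hTj j hj] at ha' hb'
      have hcj : Function.update (fun _ => C) i (Q i) j = C := by simp [hj]
      rcases ha' with rfl | rfl <;> rcases hb' with rfl | rfl
      · exact absurd rfl hab
      · have h1 := (hr Q _ hQ (hQC _ hQi) rfl hcj).1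
        have h2 := (hr Q' _ hQ' (hQC _ hQi) (h j hj) hcj).1
        rw [hval _ hQi] at h1 h2
        exact ⟨h1, h2⟩
      · have h1 := (hr _ Q (hQC _ hQi) hQ hcj rfl).2
        have h2 := (hr _ Q' (hQC _ hQi) hQ' hcj (h j hj)).2
        rw [hval _ hQi] at h1 h2
        exact ⟨h1, h2⟩
      · exact absurd rfl hab
    obtain ⟨pj, -, hpj⟩ := (Q j).2
    rcases le_total pj p with hle | hle
    · have e1 := hpj.le_of_rel hle h1.1
      have e2 := hpj.le_of_rel hle h1.2
      rcases le_total (f Q) (f Q') with hl | hl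
      · have := hp.ge_of_rel e2 hs
        omega
      · have := hp'.ge_of_rel e1 hs'
        omega
    · have e1 := hpj.ge_of_rel hle h1.1
      have e2 := hpj.ge_of_rel hle h1.2
      rcases le_total (f Q) (f Q') with hl | hl
      · have := hp'.le_of_rel e1 hs'
        omega
      · have := hp.le_of_rel e2 hs
        omega

/-- A unanimous choice function implementable in obviously dominant strategies depends on the ideal
points only. -/
theorem OSPImplementable.eq_of_same_ideals [Finite N] (hf : OSPImplementable f) (hu : Unanimous f)
    {Q Q' : N → singlePeaked Set.univ} {p : N → ℤ} (hp : ∀ i, (Q i : Pref ℤ).IsIdeal (p i))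
    (hp' : ∀ i, (Q' i : Pref ℤ).IsIdeal (p i)) : f Q = f Q' := by
  classical
  let r : N → singlePeaked Set.univ → singlePeaked Set.univ → Prop :=
    fun _ A B => ∃ p, (A : Pref ℤ).IsIdeal p ∧ (B : Pref ℤ).IsIdeal p
  have hg : ∀ i R a, r i (R i) a → f R ≤ f (Function.update R i a) := by
    rintro i R a ⟨p, h1, h2⟩
    exact (hf.eq_of_same_ideal_update hu i (fun j hj => by simp [hj]) h1 (by simpa)).le
  exact le_antisymm (le_of_forall_update hg fun i => ⟨p i, hp i, hp' i⟩)
    (le_of_forall_update hg fun i => ⟨p i, hp' i, hp i⟩)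

end TopsOnly

/-! ### Reduction to functions of the ideal points -/

/-- The properties that a unanimous choice function implementable in obviously dominant strategies
has as a function of the ideal points: whether the choice exceeds `t` depends only on which ideal
points do, and on every product of sets on which it is not constant, some agent's lower ideal point
always leads to a lower choice than her higher one, whatever the others do in either case. -/
structure IsObviousCutRule {N : Type} (F : (N → ℤ) → ℤ) : Prop where
  const : ∀ x, F (fun _ => x) = x
  cut : ∀ {t p q}, (∀ i, t < p i ↔ t < q i) → (t < F p ↔ t < F q)
  split : ∀ T : N → Set ℤ, (∃ p q, (∀ i, p i ∈ T i) ∧ (∀ i, q i ∈ T i) ∧ F p ≠ F q) →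
    ∃ i, ∃ a ∈ T i, ∃ b ∈ T i, a < b ∧ ∀ p q, (∀ j, p j ∈ T j) → (∀ j, q j ∈ T j) →
      p i = a → q i = b → F p ≤ F q

/-- If `v < u`, the second comparison forces `b ≤ v`; then `a < v < u` contradicts the first. Right
bias thus orients the outcomes of an obvious pair. -/
theorem Pref.le_of_rel_rightLexi {a b u v : ℤ} (hab : a < b) (h₁ : (rightLexi a).rel u v)
    (h₂ : (rightLexi b).rel v u) : u ≤ v := by
  simp only [rightLexi] at h₁ h₂
  omega

/-- The profile of right-biased preferences with given ideal points. -/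
def rightProfile {N : Type} (p : N → ℤ) : N → singlePeaked Set.univ :=
  fun i => ⟨Pref.rightLexi (p i), p i, trivial, Pref.isIdeal_rightLexi (p i)⟩

/-- Since only ideal points matter, each may be represented by whichever preference suits. Suppose
that an agent moves her ideal point within one side of `t` and pulls the choice from above `t` to at
most `t`. This contradicts strategyproofness: for the right-biased preference after the move if the
ideal point is above `t`, otherwise for the left-biased one before it. -/
theorem OSPImplementable.isObviousCutRule {N : Type} [Finite N] {f : SCF N (singlePeaked Set.univ)}
    (hf : OSPImplementable f) (hu : Unanimous f) :
    IsObviousCutRule fun p => f (rightProfile p) := by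
  classical
  have hid : ∀ (p : N → ℤ) i, (rightProfile p i : Pref ℤ).IsIdeal (p i) :=
    fun p i => Pref.isIdeal_rightLexi (p i)
  refine ⟨fun x => hu _ _ fun i => hid (fun _ => x) i, ?_, ?_⟩
  · have hstep : ∀ (t : ℤ) (i : N) (p : N → ℤ) b, (t < p i ↔ t < b) →
        (t < f (rightProfile p) → t < f (rightProfile (Function.update p i b))) := by
      intro t i p b hb hlt
      by_contra! hle
      have hoff : ∀ j, j ≠ i → rightProfile (Function.update p i b) j = rightProfile p j := by
        intro j hj
        simp [rightProfile, hj]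
      by_cases hp : t < p i
      · have := hf.strategyproof i (Q := rightProfile (Function.update p i b))
          (Q' := rightProfile p) fun j hj => (hoff j hj).symm
        change (Pref.rightLexi (Function.update p i b i)).rel _ _ at this
        rw [Function.update_self] at this
        simp only [Pref.rightLexi] at this
        have := hb.1 hp
        omega
      · let Q : N → singlePeaked Set.univ := Function.update (rightProfile p) i
          ⟨Pref.leftLexi (p i), p i, trivial, Pref.isIdeal_leftLexi (p i)⟩
        have hQ : f Q = f (rightProfile p) := by
          refine hf.eq_of_same_ideals hu (p := p) (fun j => ?_) (hid p)
          by_cases hj : j = i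
          · subst hj
            simpa [Q] using Pref.isIdeal_leftLexi (p j)
          · simpa [Q, hj] using hid p j
        have h1 := hf.strategyproof i (Q := Q) (Q' := rightProfile (Function.update p i b)) <| by
          intro j hj
          exact (hoff j hj).trans (Function.update_of_ne hj _ _).symm
        rw [hQ] at h1
        simp only [Q, Function.update_self, Pref.leftLexi] at h1
        omega
    intro t p q hpq
    -- Propositions are ordered by implication, so the single changes combine to a change of the
    -- whole profile.
    exact ⟨le_of_forall_update (β := Prop) (r := fun _ a b => t < a ↔ t < b)
        (g := fun p => t < f (rightProfile p)) (fun i R a h => hstep t i R a h) hpq,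
      le_of_forall_update (β := Prop) (r := fun _ a b => t < a ↔ t < b)
        (g := fun p => t < f (rightProfile p)) (fun i R a h => hstep t i R a h)
        fun i => (hpq i).symm⟩
  · rintro T ⟨p, q, hp, hq, hne⟩
    let T' : N → Set (singlePeaked Set.univ) := fun i =>
      {A | ∃ x ∈ T i, A = ⟨Pref.rightLexi x, x, trivial, Pref.isIdeal_rightLexi x⟩}
    have hmem : ∀ p : N → ℤ, (∀ i, p i ∈ T i) → ∀ i, rightProfile p i ∈ T' i :=
      fun p hp i => ⟨p i, hp i, rfl⟩
    obtain ⟨i, _, ⟨a, ha, rfl⟩, _, ⟨b, hb, rfl⟩, hab, hr⟩ :=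
      hf.exists_obvious_pair T' ⟨_, _, hmem p hp, hmem q hq, hne⟩
    have hab' : a ≠ b := by rintro rfl; exact hab rfl
    rcases hab'.lt_or_gt with hlt | hlt
    · refine ⟨i, a, ha, b, hb, hlt, fun p q hp hq hpi hqi => ?_⟩
      obtain ⟨h1, h2⟩ := hr _ _ (hmem p hp) (hmem q hq) (by simp [rightProfile, hpi])
        (by simp [rightProfile, hqi])
      exact Pref.le_of_rel_rightLexi hlt h1 h2
    · refine ⟨i, b, hb, a, ha, hlt, fun p q hp hq hpi hqi => ?_⟩
      obtain ⟨h1, h2⟩ := hr _ _ (hmem q hq) (hmem p hp) (by simp [rightProfile, hqi])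
        (by simp [rightProfile, hpi])
      exact Pref.le_of_rel_rightLexi hlt h2 h1

/-! ### Proto-dictatorships as Boolean functions -/

namespace ProtoDictatorship

variable {N : Type}

/-- The proto-dictatorship results in its first option when `P i` says that `i` prefers it. -/
def ChoosesFirst (P : N → Prop) : ProtoDictatorship N → Prop
  | last i => P i
  | offer i true rest => P i ∨ rest.ChoosesFirst P
  | offer i false rest => P i ∧ rest.ChoosesFirst P

theorem result_of_choosesFirst {Y : Type} {R : N → Pref Y} {y z : Y} {P : N → Prop}
    (h₁ : ∀ i, (R i).strict y z ↔ P i) (h₂ : ∀ i, (R i).strict z y ↔ ¬ P i)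
    (π : ProtoDictatorship N) :
    (π.ChoosesFirst P → π.result R y z = y) ∧ (¬ π.ChoosesFirst P → π.result R y z = z) := by
  classical
  induction π with
  | last i => simp only [ChoosesFirst, result, h₁]; constructor <;> intro h <;> simp [h]
  | offer i b rest ih =>
    cases b
    · by_cases hP : P i
      · simp only [ChoosesFirst, result, h₂, hP]
        simpa using ih
      · simp [ChoosesFirst, result, h₂, hP]
    · by_cases hP : P i
      · simp [ChoosesFirst, result, h₁, hP]
      · simp only [ChoosesFirst, result, h₁, hP]
        simpa using ih

theorem choosesFirst_congr {P Q : N → Prop} {π : ProtoDictatorship N}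
    (h : ∀ i, P i ↔ Q i) : π.ChoosesFirst P ↔ π.ChoosesFirst Q := by
  rw [show P = Q from funext fun i => propext (h i)]

end ProtoDictatorship

/-! ### Dictator, blocking and arbitration in an obvious cut rule -/

namespace IsObviousCutRule

variable {N : Type} {F : (N → ℤ) → ℤ}

/-- All three properties are symmetric, so only the right side of the center needs analysis. -/
theorem reflect (hF : IsObviousCutRule F) : IsObviousCutRule fun p => -F fun i => -p i := by
  refine ⟨fun x => by simp [hF.const], ?_, ?_⟩
  · intro t p q hpq
    -- For integers, `t < -y` fails exactly when `-t - 1 < y`.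
    have := hF.cut (t := -t - 1) (p := fun i => -p i) (q := fun i => -q i) fun i => by
      have := hpq i
      omega
    omega
  · rintro T ⟨p, q, hp, hq, hne⟩
    obtain ⟨i, a, ha, b, hb, hab, hr⟩ := hF.split (fun i => {x | -x ∈ T i})
      ⟨fun i => -p i, fun i => -q i, fun i => by simpa using hp i, fun i => by simpa using hq i,
        fun h => hne (by simp only [h])⟩
    refine ⟨i, -b, hb, -a, ha, by omega, fun p q hp hq hpi hqi => ?_⟩
    have := hr (fun i => -q i) (fun i => -p i) (fun i => by simpa using hq i)
      (fun i => by simpa using hp i) (by omega) (by omega)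
    omega

theorem le_of_forall_le (hF : IsObviousCutRule F) {t : ℤ} {p : N → ℤ} (h : ∀ i, p i ≤ t) :
    F p ≤ t := by
  have := (hF.cut (t := t) (p := p) (q := fun _ => t) fun i => by have := h i; omega)
  rw [hF.const] at this
  omega

theorem le_of_forall_ge (hF : IsObviousCutRule F) {t : ℤ} {p : N → ℤ} (h : ∀ i, t ≤ p i) :
    t ≤ F p := by
  have := (hF.cut (t := t - 1) (p := p) (q := fun _ => t) fun i => by have := h i; omega)
  rw [hF.const] at this
  omega

/-- A choice between two adjacent policies is a proto-dictatorship. -/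
theorem exists_protoDictatorship [Finite N] (hF : IsObviousCutRule F) (t : ℤ) (T : N → Set ℤ)
    (hT : ∀ i, ∀ x ∈ T i, x = t ∨ x = t + 1)
    (hne : ∃ p q, (∀ i, p i ∈ T i) ∧ (∀ i, q i ∈ T i) ∧ F p ≤ t ∧ t < F q) :
    ∃ π : ProtoDictatorship N, π.agents.Nodup ∧
      (∀ i ∈ π.agents, t ∈ T i ∧ t + 1 ∈ T i) ∧
      ∀ p, (∀ i, p i ∈ T i) → (F p ≤ t ↔ π.ChoosesFirst fun i => p i ≤ t) := by
  classical
  cases nonempty_fintype N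
  -- The induction is on the number of agents who still have both options. Fixing the agent of the
  -- obvious pair lowers it and keeps her out of the rest of the stream.
  induction hn : (Finset.univ.filter fun i => t ∈ T i ∧ t + 1 ∈ T i).card using Nat.strong_induction_on
    generalizing T with
  | _ n ih =>
  obtain ⟨p, q, hp, hq, hFp, hFq⟩ := hne
  have hval : ∀ p, (∀ i, p i ∈ T i) → F p = t ∨ F p = t + 1 := by
    intro p hp
    have h1 := hF.le_of_forall_le (t := t + 1) (p := p) fun i => by
      rcases hT i _ (hp i) with h | h <;> omega
    have h2 := hF.le_of_forall_ge (t := t) (p := p) fun i => by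
      rcases hT i _ (hp i) with h | h <;> omega
    omega
  obtain ⟨i, a, ha, b, hb, hab, hr⟩ := hF.split T ⟨p, q, hp, hq, by omega⟩
  have hat : a = t := by rcases hT i a ha with h | h <;> rcases hT i b hb with h' | h' <;> omega
  have hbt : b = t + 1 := by rcases hT i a ha with h | h <;> rcases hT i b hb with h' | h' <;> omega
  subst hat hbt
  have hsub : ∀ x ∈ T i, ∀ j, ∀ y ∈ Function.update T i {x} j, y ∈ T j := by
    intro x hx j y hy
    by_cases hj : j = i
    · subst hj
      rw [Function.update_self] at hy
      rwa [Set.mem_singleton_iff.1 hy]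
    · rwa [Function.update_of_ne hj] at hy
  have hupd : ∀ x (p : N → ℤ), (∀ j, p j ∈ T j) → p i = x → ∀ j, p j ∈ Function.update T i {x} j := by
    intro x p hp hx j
    by_cases hj : j = i
    · subst hj
      rw [Function.update_self]
      exact hx
    · rw [Function.update_of_ne hj]
      exact hp j
  have hcard : ∀ x, (Finset.univ.filter fun j => a ∈ Function.update T i {x} j ∧
      a + 1 ∈ Function.update T i {x} j).card < n := by
    intro x
    rw [← hn]
    apply Finset.card_lt_card
    rw [Finset.ssubset_iff_of_subset]
    · refine ⟨i, by simp [ha, hb], ?_⟩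
      simp only [Finset.mem_filter, Function.update_self, Set.mem_singleton_iff]
      omega
    · intro j
      by_cases hj : j = i
      · subst hj
        intro _
        simp [ha, hb]
      · simp [Function.update_of_ne hj]
  have hagents : ∀ x, ∀ j, a ∈ Function.update T i {x} j ∧ a + 1 ∈ Function.update T i {x} j →
      j ≠ i ∧ a ∈ T j ∧ a + 1 ∈ T j := by
    intro x j hj
    by_cases hji : j = i
    · subst hji
      simp only [Function.update_self, Set.mem_singleton_iff] at hj
      omega
    · rw [Function.update_of_ne hji] at hj
      exact ⟨hji, hj⟩
  -- Here `a` has replaced `t`. Either `i` secures `a` by having it as ideal point, and is offered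
  -- it; or some profile with `i` at `a` gives `a + 1`, and then the order of the pair makes `a + 1`
  -- certain when `i` is at `a + 1`, so she is offered that.
  by_cases hA : ∀ p, (∀ j, p j ∈ T j) → p i = a → F p ≤ a
  · have hqi : q i = a + 1 := by
      rcases hT i _ (hq i) with h | h
      · have := hA q hq h
        omega
      · exact h
    by_cases hB : ∃ p, (∀ j, p j ∈ T j) ∧ p i = a + 1 ∧ F p ≤ a
    · obtain ⟨p', hp', hpi', hFp'⟩ := hB
      obtain ⟨π, h1, h2, h3⟩ := ih _ (hcard (a + 1)) (Function.update T i {a + 1})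
        (fun j x hx => hT j x (hsub _ hb j x hx))
        ⟨p', q, hupd _ _ hp' hpi', hupd _ _ hq hqi, hFp', hFq⟩ rfl
      refine ⟨.offer i true π, ?_, ?_, ?_⟩
      · exact List.nodup_cons.2 ⟨fun hi => (hagents _ i (h2 i hi)).1 rfl, h1⟩
      · intro j hj
        rcases List.mem_cons.1 hj with rfl | hj
        · exact ⟨ha, hb⟩
        · exact (hagents _ j (h2 j hj)).2
      · intro p hp
        rcases hT i _ (hp i) with h | h
        · exact iff_of_true (hA p hp h) (Or.inl h.le)
        · rw [h3 p (hupd _ _ hp h)]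
          exact (or_iff_right (by omega)).symm
    · push Not at hB
      refine ⟨.last i, List.nodup_singleton i, ?_, ?_⟩
      · intro j hj
        rw [List.mem_singleton.1 hj]
        exact ⟨ha, hb⟩
      · intro p hp
        rcases hT i _ (hp i) with h | h
        · exact iff_of_true (hA p hp h) h.le
        · exact iff_of_false (hB p hp h).not_ge (by simp only [ProtoDictatorship.ChoosesFirst]; omega)
  · push Not at hA
    obtain ⟨p', hp', hpi', hFp'⟩ := hA
    have hB : ∀ q, (∀ j, q j ∈ T j) → q i = a + 1 → a < F q := fun q hq hqi =>
      hFp'.trans_le (hr p' q hp' hq hpi' hqi)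
    have hpi : p i = a := by
      rcases hT i _ (hp i) with h | h
      · exact h
      · have := hB p hp h
        omega
    obtain ⟨π, h1, h2, h3⟩ := ih _ (hcard a) (Function.update T i {a})
      (fun j x hx => hT j x (hsub _ ha j x hx))
      ⟨p, p', hupd _ _ hp hpi, hupd _ _ hp' hpi', hFp, hFp'⟩ rfl
    refine ⟨.offer i false π, ?_, ?_, ?_⟩
    · exact List.nodup_cons.2 ⟨fun hi => (hagents _ i (h2 i hi)).1 rfl, h1⟩
    · intro j hj
      rcases List.mem_cons.1 hj with rfl | hj
      · exact ⟨ha, hb⟩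
      · exact (hagents _ j (h2 j hj)).2
    · intro p hp
      rcases hT i _ (hp i) with h | h
      · rw [h3 p (hupd _ _ hp h)]
        exact (and_iff_right h.le).symm
      · exact iff_of_false (hB p hp h).not_ge fun hc => absurd hc.1 (by omega)

/-- There is a dictator: above the center the choice never exceeds her ideal point, below it it
never falls short of it. -/
theorem exists_dictator (hF : IsObviousCutRule F) :
    ∃ (d : N) (x : ℤ), (∀ t p, x ≤ t → p d ≤ t → F p ≤ t) ∧
      ∀ t p, t < x → t < p d → t < F p := by
  classical
  obtain ⟨d, a, -, b, -, hab, hr⟩ := hF.split (fun _ => Set.univ)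
    ⟨fun _ => 0, fun _ => 1, by simp, by simp, by simp [hF.const]⟩
  replace hr : ∀ p q : N → ℤ, p d = a → q d = b → F p ≤ F q := fun p q =>
    hr p q (fun _ => trivial) fun _ => trivial
  -- A value separating the choices at `a` from those at `b` serves as the center. By the cut
  -- property `a` then stands for all ideal points up to `t` when `x ≤ t`, and `b` for all those
  -- above `t` when `t < x`.
  obtain ⟨x, hx₁, hx₂⟩ : ∃ x, (∀ p : N → ℤ, p d = a → F p ≤ x) ∧ ∀ q : N → ℤ, q d = b → x ≤ F q := by
    obtain ⟨x, ⟨p, hp, rfl⟩, hx⟩ := Int.exists_greatest_of_bdd (P := fun x => ∃ p, p d = a ∧ F p = x)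
      ⟨b, by rintro _ ⟨p, hp, rfl⟩; simpa [hF.const] using hr p (fun _ => b) hp rfl⟩
      ⟨a, fun _ => a, rfl, hF.const a⟩
    exact ⟨F p, fun p' hp' => hx _ ⟨p', hp', rfl⟩, fun q hq => hr p q hp hq⟩
  have hax : a ≤ x := by simpa [hF.const] using hx₁ (fun _ => a) rfl
  have hxb : x ≤ b := by simpa [hF.const] using hx₂ (fun _ => b) rfl
  refine ⟨d, x, ?_, ?_⟩
  · intro t p hxt hpt
    by_contra! hlt
    have h1 := (hF.cut (t := t) (p := p) (q := Function.update p d a) fun i => by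
      by_cases hi : i = d
      · subst hi; simp; omega
      · simp [hi]).1 hlt
    have h2 := hx₁ (Function.update p d a) (by simp)
    omega
  · intro t p htx htp
    refine (hF.cut (t := t) (p := p) (q := Function.update p d b) fun i => ?_).2 ?_
    · by_cases hi : i = d
      · subst hi; simp; omega
      · simp [hi]
    · exact htx.trans_le (hx₂ _ (by simp))

/-- Agent `i` can keep the choice from exceeding `t`. -/
def Blocks (F : (N → ℤ) → ℤ) (i : N) (t : ℤ) : Prop := ∀ p, p i ≤ t → F p ≤ t

/-- An ideal point up to `t` can be replaced by `s` without carrying the choice across `t`. Hence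
blocking is described by a threshold. -/
theorem Blocks.mono (hF : IsObviousCutRule F) {i : N} {s t : ℤ} (h : Blocks F i s) (hst : s ≤ t) :
    Blocks F i t := by
  classical
  intro p hp
  by_contra! hlt
  have h1 := (hF.cut (t := t) (p := p) (q := Function.update p i s) fun j => by
    by_cases hj : j = i
    · subst hj; simp; omega
    · simp [hj]).1 hlt
  have := h (Function.update p i s) (by simp)
  omega

/-- When no agent blocks `t`, then the choice exceeds `t`, or this is decided by an agent who can
block `t + 1` and otherwise by a proto-dictatorship. -/
theorem exists_arbitrator [Finite N] (hF : IsObviousCutRule F) {d : N} {t : ℤ}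
    (hd : Blocks F d t) :
    (∀ p, (∀ i, Blocks F i t → t < p i) → t < F p) ∨
    ∃ (i : N) (π : ProtoDictatorship N), ¬ Blocks F i t ∧ Blocks F i (t + 1) ∧ π.agents.Nodup ∧
      ∀ p, (∀ j, Blocks F j t → t < p j) →
        (F p ≤ t ↔ p i ≤ t ∧ π.ChoosesFirst fun j => p j ≤ t) := by
  classical
  by_cases hcase : ∀ p, (∀ i, Blocks F i t → t < p i) → t < F p
  · exact Or.inl hcase
  right
  push Not at hcase
  obtain ⟨p₀, hp₀, hFp₀⟩ := hcase
  -- Nobody uses a block at `t`, and ideal points below `t` are raised to `t`, which by the cut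
  -- property does not affect whether the choice exceeds `t`.
  let T : N → Set ℤ := fun j => {x | t ≤ x ∧ (Blocks F j t → t < x)}
  have hT : ∀ p : N → ℤ, (∀ j, Blocks F j t → t < p j) → ∃ p' : N → ℤ, (∀ j, p' j ∈ T j) ∧
      (∀ j, t < p j → p' j = p j) ∧ ∀ j, p j ≤ t → p' j = t := by
    intro p hp
    refine ⟨fun j => max t (p j), fun j => ⟨le_max_left _ _, fun hj => lt_max_of_lt_right (hp j hj)⟩,
      fun j hj => max_eq_right hj.le, fun j hj => max_eq_left hj⟩
  have hconst : ∀ x, t < x → ∀ j, (fun _ => x : N → ℤ) j ∈ T j := fun x hx j => ⟨hx.le, fun _ => hx⟩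
  obtain ⟨p₁, hp₁, hp₁', hp₁''⟩ := hT p₀ hp₀
  have hF₁ : F p₁ ≤ t := by
    by_contra! hlt
    have := (hF.cut (t := t) (p := p₁) (q := p₀) fun j => by
      rcases lt_or_ge t (p₀ j) with h | h
      · rw [hp₁' j h]
      · rw [hp₁'' j h]; omega).1 hlt
    omega
  obtain ⟨i, a, ha, b, hb, hab, hr⟩ := hF.split T
    ⟨p₁, fun _ => t + 1, hp₁, hconst _ (by omega), by rw [hF.const]; omega⟩
  have hup : ∀ (p : N → ℤ) x, x ∈ T i → (∀ j, p j ∈ T j) → ∀ j, Function.update p i x j ∈ T j := by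
    intro p x hx hp j
    by_cases hj : j = i
    · subst hj; simpa using hx
    · simpa [hj] using hp j
  have hat : t ≤ a := ha.1
  -- Otherwise `a > t`. Moving `i` from her place in `p₁` to `b` stays above `t`, so the choice
  -- stays at most `t`, although it should be at least `a`, the choice when all are at `a`.
  have hib : ¬ Blocks F i t := by
    intro hi
    have hta := ha.2 hi
    have h1 := hr (fun _ => a) (Function.update p₁ i b) (hconst a hta) (hup _ _ hb hp₁) rfl (by simp)
    rw [hF.const] at h1
    have h2 := (hF.cut (t := t) (p := Function.update p₁ i b) (q := p₁) fun j => by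
      by_cases hj : j = i
      · subst hj; simp only [Function.update_self]; have := (hp₁ j).2 hi; omega
      · simp [hj]).1 (by omega)
    omega
  have hdi : d ≠ i := fun h => hib (h ▸ hd)
  -- Compare with `i` at `b` and all others at `t + 1`, where `d` blocks.
  have hle : ∀ p, (∀ j, p j ∈ T j) → p i = a → F p ≤ t + 1 := by
    intro p hp hpi
    refine (hr p (Function.update (fun _ => t + 1) i b) hp
      (hup _ _ hb (hconst _ (by omega))) hpi (by simp)).trans ?_
    exact hd.mono hF (by omega) _ (by simp [hdi])
  have hat' : a ≤ t + 1 := by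
    rcases hat.eq_or_lt with h | h
    · omega
    · simpa [hF.const] using hle (fun _ => a) (hconst _ h) rfl
  have hib' : Blocks F i (t + 1) := by
    intro p hp
    by_contra! hlt
    have h1 := hle (fun j => if j = i then a else max (t + 1) (p j)) (fun j => ?_) (by simp)
    · have := (hF.cut (t := t + 1) (p := p) (q := fun j => if j = i then a else max (t + 1) (p j))
        fun j => by
          by_cases hj : j = i
          · subst hj; simp only [if_true]; omega
          · simp [hj]).1 hlt
      omega
    · by_cases hj : j = i
      · subst hj; simpa using ha
      · simp only [hj, if_false]
        exact ⟨by have := le_max_left (t + 1) (p j); omega,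
          fun _ => by have := le_max_left (t + 1) (p j); omega⟩
  -- It suffices that one profile with `i` at `a` leads above `t`. If `a = t` there is one because
  -- `i` does not block `t`; if `a > t`, the constant profile will do.
  have hgt : ∀ p, (∀ j, p j ∈ T j) → p i = b → t < F p := by
    obtain ⟨p', hp', hpi', hFp'⟩ : ∃ p', (∀ j, p' j ∈ T j) ∧ p' i = a ∧ t < F p' := by
      rcases hat.eq_or_lt with h | h
      · obtain ⟨p, hpi, hFp⟩ : ∃ p, p i ≤ t ∧ t < F p := by
          unfold Blocks at hib
          push Not at hib
          exact hib
        obtain ⟨p', h1, h2, h3⟩ := hT p fun j hj => by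
          by_contra! hle
          have := hj p hle
          omega
        refine ⟨p', h1, by rw [h3 i hpi, h], ?_⟩
        refine (hF.cut fun j => ?_).1 hFp
        rcases lt_or_ge t (p j) with h | h
        · rw [h2 j h]
        · rw [h3 j h]; omega
      · exact ⟨fun _ => a, hconst a h, rfl, by rwa [hF.const]⟩
    intro p hp hpi
    exact hFp'.trans_le (hr p' p hp' hp hpi' hpi)
  have hgt' : ∀ p, (∀ j, Blocks F j t → t < p j) → t < p i → t < F p := by
    intro p hp hpi
    obtain ⟨p', h1, h2, h3⟩ := hT p hp
    refine (hF.cut (q := Function.update p' i b) fun j => ?_).2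
      (hgt (Function.update p' i b) (hup _ _ hb h1) (by simp))
    by_cases hj : j = i
    · subst hj; simp only [Function.update_self]; omega
    · rw [Function.update_of_ne hj]
      rcases lt_or_ge t (p j) with h | h
      · rw [h2 j h]
      · rw [h3 j h]; omega
  obtain ⟨q₀, hq₀i, hFq₀⟩ : ∃ p, p i ≤ t ∧ t < F p := by
    unfold Blocks at hib
    push Not at hib
    exact hib
  have hq₀ : ∀ j, Blocks F j t → t < q₀ j := by
    intro j hj
    by_contra! hle
    have := hj q₀ hle
    omega
  -- There remains the case `p i ≤ t`. Rounding ideal points to `t` or `t + 1` leaves a binary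
  -- choice in which `i` and the blockers of `t` are fixed.
  let T' : N → Set ℤ := fun j =>
    {x | (x = t ∨ x = t + 1) ∧ (Blocks F j t → x = t + 1) ∧ (j = i → x = t)}
  let c : (N → ℤ) → N → ℤ := fun p j => if t < p j then t + 1 else t
  have hc : ∀ p, t < F (c p) ↔ t < F p := fun p => hF.cut fun j => by
    simp only [c]; split_ifs <;> omega
  have hcT : ∀ p, (∀ j, Blocks F j t → t < p j) → p i ≤ t → ∀ j, c p j ∈ T' j := by
    intro p hp hpi j
    refine ⟨by simp only [c]; split_ifs <;> simp, fun hj => if_pos (hp j hj), ?_⟩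
    rintro rfl
    exact if_neg hpi.not_gt
  have hp₀i : p₀ i ≤ t := by
    by_contra! hlt
    have := hgt' p₀ hp₀ hlt
    omega
  obtain ⟨π, h1, -, h3⟩ := hF.exists_protoDictatorship t T' (fun j x hx => hx.1)
    ⟨c p₀, c q₀, hcT p₀ hp₀ hp₀i, hcT q₀ hq₀ hq₀i, by have := hc p₀; omega, by have := hc q₀; omega⟩
  refine ⟨i, π, hib, hib', h1, fun p hp => ?_⟩
  rcases lt_or_ge t (p i) with h | h
  · have := hgt' p hp h
    exact iff_of_false (by omega) fun hh => absurd hh.1 (by omega)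
  · have e1 := hc p
    have e2 := h3 (c p) (hcT p hp h)
    rw [ProtoDictatorship.choosesFirst_congr (Q := fun j => p j ≤ t)] at e2
    · rw [← e2, and_iff_right h]
      omega
    · intro j
      simp only [c]; split_ifs <;> omega

end IsObviousCutRule

namespace IsObviousCutRule

variable {N : Type} [Finite N] {F : (N → ℤ) → ℤ}

/-- The blocking bounds and arbitrators on the right of the center, and the resulting choice. -/
theorem exists_right_safeguards (hF : IsObviousCutRule F) {d : N} {x : ℤ}
    (hd : ∀ t p, x ≤ t → p d ≤ t → F p ≤ t) (hd' : ∀ t p, t < x → t < p d → t < F p) :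
    ∃ (r : N → Option ℤ) (arb : ℤ → Option (N × ProtoDictatorship N)),
      (∀ i k, r i = some k → x ≤ k) ∧
      (∀ y i π, arb y = some (i, π) → x < y ∧ i ≠ d ∧ r i = some y ∧ π.agents.Nodup) ∧
      ∀ p : N → ℤ, x ≤ p d → ∃ b, x ≤ b ∧ b ≤ p d ∧
        (∀ i, i ≠ d → ∀ k, r i = some k → b ≤ max k (p i)) ∧
        (b = p d ∨ ∃ i, i ≠ d ∧ ∃ k, r i = some k ∧ max k (p i) ≤ b) ∧
        ((F p = b - 1 ∧ ∃ i π, arb b = some (i, π) ∧ p i ≤ b - 1 ∧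
            π.ChoosesFirst fun j => p j ≤ b - 1) ∨
          (F p = b ∧ ∀ i π, arb b = some (i, π) → p i ≤ b - 1 →
            ¬ π.ChoosesFirst fun j => p j ≤ b - 1)) := by
  classical
  -- The bound is the least cut from `x` on that `i` blocks, if there is one.
  have hr : ∀ i, ∃ o : Option ℤ, (∀ k, o = some k → x ≤ k) ∧
      ∀ t, x ≤ t → (Blocks F i t ↔ ∃ k, o = some k ∧ k ≤ t) := by
    intro i
    by_cases h : ∃ t, x ≤ t ∧ Blocks F i t
    · obtain ⟨k, ⟨hk₁, hk₂⟩, hk⟩ :=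
        Int.exists_least_of_bdd (P := fun t => x ≤ t ∧ Blocks F i t) ⟨x, fun _ hz => hz.1⟩ h
      refine ⟨some k, fun _ h => by cases h; exact hk₁, fun t ht =>
        ⟨fun hb => ⟨k, rfl, hk t ⟨ht, hb⟩⟩, ?_⟩⟩
      rintro ⟨_, hk', hkt⟩
      cases hk'
      exact hk₂.mono hF hkt
    · push Not at h
      exact ⟨none, by simp, fun t ht => by simpa using h t ht⟩
  choose r hrx hr using hr
  have harb : ∀ y, ∃ o : Option (N × ProtoDictatorship N),
      (∀ i π, o = some (i, π) → x < y ∧ i ≠ d ∧ r i = some y ∧ π.agents.Nodup) ∧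
      (x < y → ∀ p : N → ℤ, (∀ i, Blocks F i (y - 1) → y - 1 < p i) →
        (F p ≤ y - 1 ↔ ∃ i π, o = some (i, π) ∧ p i ≤ y - 1 ∧
          π.ChoosesFirst fun j => p j ≤ y - 1)) := by
    intro y
    by_cases hy : x < y
    · have hdb : Blocks F d (y - 1) := fun p hp => hd _ p (by omega) hp
      rcases hF.exists_arbitrator hdb with h | ⟨i, π, h1, h2, h3, h4⟩
      · refine ⟨none, by simp, fun _ p hp => ?_⟩
        have := h p hp
        simp only [reduceCtorEq, false_and, exists_false, iff_false]
        omega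
      · rw [hr i _ (by omega)] at h1 h2
        obtain ⟨k, hk, hky⟩ := h2
        -- The arbitrator blocks `y` but not `y - 1`, so her bound is exactly `y`.
        have hky' : k = y := by
          by_contra hne
          exact h1 ⟨k, hk, by omega⟩
        subst hky'
        refine ⟨some (i, π), ?_, fun _ p hp => ?_⟩
        · intro i' π' he
          cases he
          refine ⟨hy, ?_, hk, h3⟩
          rintro rfl
          exact h1 ((hr _ _ (by omega)).1 hdb)
        · rw [h4 p hp]
          constructor
          · exact fun h => ⟨i, π, rfl, h⟩
          · rintro ⟨_, _, he, h⟩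
            cases he
            exact h
    · exact ⟨none, by simp, fun h => absurd h hy⟩
  choose arb harb₁ harb₂ using harb
  refine ⟨r, arb, hrx, harb₁, fun p hpd => ?_⟩
  -- `b` is the rightmost policy up to the dictator's ideal point that respects all bounds; by
  -- maximality the dictator or a blocker stops there.
  obtain ⟨b, ⟨hbd, hb⟩, hbmax⟩ := Int.exists_greatest_of_bdd
    (P := fun b => b ≤ p d ∧ ∀ i, i ≠ d → ∀ k, r i = some k → b ≤ max k (p i))
    ⟨p d, fun _ h => h.1⟩ ⟨x, hpd, fun i _ k hk => le_max_of_le_left (hrx i k hk)⟩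
  have hxb : x ≤ b := hbmax x ⟨hpd, fun i _ k hk => le_max_of_le_left (hrx i k hk)⟩
  have hlast : b = p d ∨ ∃ i, i ≠ d ∧ ∃ k, r i = some k ∧ max k (p i) ≤ b := by
    by_contra! h
    have := hbmax (b + 1) ⟨by omega, fun i hi k hk => by have := h.2 i hi k hk; omega⟩
    omega
  have hup : F p ≤ b := by
    rcases hlast with h | ⟨i, hi, k, hk, hkb⟩
    · exact hd b p hxb h.ge
    · exact (hr i b hxb).2 ⟨k, hk, (le_max_left _ _).trans hkb⟩ p ((le_max_right _ _).trans hkb)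
  have hlow : ∀ y, x < y → y ≤ b → ∀ i, Blocks F i (y - 1) → y - 1 < p i := by
    intro y hxy hyb i hi
    obtain ⟨k, hk, hky⟩ := (hr i _ (by omega)).1 hi
    by_cases hid : i = d
    · subst hid; omega
    · have := hb i hid k hk
      omega
  refine ⟨b, hxb, hbd, hb, hlast, ?_⟩
  rcases hxb.eq_or_lt with rfl | hlt
  · refine Or.inr ⟨le_antisymm hup ?_, fun i π h => absurd (harb₁ _ _ _ h).1 (lt_irrefl _)⟩
    have := hd' (x - 1) p (by omega) (by omega)
    omega
  -- An arbitrator at `b - 1` has bound `b - 1`. As `b` respects it, her ideal point is at least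
  -- `b`, so she does not call for arbitration.
  have hdown : b - 1 ≤ F p := by
    by_cases hb1 : x < b - 1
    · by_contra! hlt'
      obtain ⟨i, π, he, hpi, -⟩ := (harb₂ (b - 1) hb1 p (hlow _ hb1 (by omega))).1 (by omega)
      obtain ⟨-, hid, hri, -⟩ := harb₁ _ _ _ he
      have := hb i hid _ hri
      omega
    · have := hd' (x - 1) p (by omega) (by omega)
      omega
  have hiff := harb₂ b hlt p (hlow b hlt le_rfl)
  by_cases hle : F p ≤ b - 1
  · exact Or.inl ⟨by omega, hiff.1 hle⟩
  · refine Or.inr ⟨by omega, fun i π he hpi hπ => hle (hiff.2 ⟨i, π, he, hpi, hπ⟩)⟩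

end IsObviousCutRule

/-! ### Approved policies and arbitration in terms of ideal points -/

namespace SafeguardedDictatorship

variable {N : Type} (s : SafeguardedDictatorship N) {R : N → Pref ℤ} {p : N → ℤ}

theorem mem_approved_iff (hp : ∀ i, (R i).IsIdeal (p i)) {y : ℤ} :
    y ∈ s.approved R ↔ ∀ i, i ≠ s.dictator →
      (∀ k : ℤ, s.left i = (k : WithBot ℤ) → min k (p i) ≤ y) ∧
      (∀ k : ℤ, s.right i = (k : WithTop ℤ) → y ≤ max k (p i)) := by
  simp only [approved, Set.mem_ofPred_eq, (hp _).isBest_Ici_iff, (hp _).isBest_Iic_iff, forall_eq]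

theorem center_mem_approved (hp : ∀ i, (R i).IsIdeal (p i)) : s.center ∈ s.approved R := by
  rw [s.mem_approved_iff hp]
  refine fun i hi => ⟨fun k hk => ?_, fun k hk => ?_⟩
  · have := s.left_le i hi
    rw [hk, WithBot.coe_le_coe] at this
    exact min_le_of_left_le this
  · have := s.le_right i hi
    rw [hk, WithTop.coe_le_coe] at this
    exact le_max_of_le_left this

/-- Either `b` is the dictator's ideal point, or some agent's bound caps the approved policies at
`b`, on the near side of it. -/
theorem isBest_of_right (hp : ∀ i, (R i).IsIdeal (p i)) {b : ℤ} (hb : b ∈ s.approved R)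
    (hle : b ≤ p s.dictator) (h : b = p s.dictator ∨ ∃ i, i ≠ s.dictator ∧ ∃ k : ℤ,
      s.right i = (k : WithTop ℤ) ∧ max k (p i) ≤ b) :
    (R s.dictator).IsBest (s.approved R) b := by
  refine ⟨hb, fun z hz => ?_⟩
  rcases h with h | ⟨i, hi, k, hk, hkb⟩
  · rw [h]
    exact (hp _).rel_ideal z
  · exact (hp _).rel_left ((((s.mem_approved_iff hp).1 hz i hi).2 k hk).trans hkb) hle

theorem isBest_of_left (hp : ∀ i, (R i).IsIdeal (p i)) {b : ℤ} (hb : b ∈ s.approved R)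
    (hle : p s.dictator ≤ b) (h : b = p s.dictator ∨ ∃ i, i ≠ s.dictator ∧ ∃ k : ℤ,
      s.left i = (k : WithBot ℤ) ∧ b ≤ min k (p i)) :
    (R s.dictator).IsBest (s.approved R) b := by
  refine ⟨hb, fun z hz => ?_⟩
  rcases h with h | ⟨i, hi, k, hk, hkb⟩
  · rw [h]
    exact (hp _).rel_ideal z
  · exact (hp _).rel_right hle (hkb.trans (((s.mem_approved_iff hp).1 hz i hi).1 k hk))

theorem arbLeft_eq_none {b : ℤ} (h : s.center ≤ b) : s.arbLeft b = none := by
  rcases hb : s.arbLeft b with _ | ⟨i, π⟩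
  · rfl
  · exact absurd (s.arbLeft_spec _ _ _ hb).1 h.not_gt

theorem arbRight_eq_none {b : ℤ} (h : b ≤ s.center) : s.arbRight b = none := by
  rcases hb : s.arbRight b with _ | ⟨i, π⟩
  · rfl
  · exact absurd (s.arbRight_spec _ _ _ hb).1 h.not_gt

theorem arbitrate_of_none {b : ℤ} (hr : s.arbRight b = none) (hl : s.arbLeft b = none) :
    s.arbitrate R b = b := by
  unfold arbitrate
  rw [hr, hl]

theorem arbitrate_of_arbRight {b : ℤ} {i : N} {π : ProtoDictatorship N}
    (h : s.arbRight b = some (i, π)) (hp : ∀ i, (R i).IsIdeal (p i)) :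
    (p i ≤ b - 1 → s.arbitrate R b = π.result R (b - 1) b) ∧
      (b ≤ p i → s.arbitrate R b = b) := by
  unfold arbitrate
  rw [h]
  simp only [(hp i).strict_pred_iff]
  exact ⟨fun h => if_pos h, fun h => if_neg (by omega)⟩

theorem arbitrate_of_arbLeft {b : ℤ} {i : N} {π : ProtoDictatorship N}
    (h : s.arbLeft b = some (i, π)) (hp : ∀ i, (R i).IsIdeal (p i)) :
    (b + 1 ≤ p i → s.arbitrate R b = π.result R (b + 1) b) ∧
      (p i ≤ b → s.arbitrate R b = b) := by
  unfold arbitrate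
  rw [s.arbRight_eq_none (s.arbLeft_spec _ _ _ h).1.le, h]
  simp only [(hp i).strict_succ_iff]
  exact ⟨fun h => if_pos h, fun h => if_neg (by omega)⟩

end SafeguardedDictatorship

namespace ProtoDictatorship

variable {N : Type} {R : N → Pref ℤ} {p : N → ℤ} {b : ℤ}

theorem result_pred (hp : ∀ i, (R i).IsIdeal (p i)) (π : ProtoDictatorship N) :
    ((π.ChoosesFirst fun i => p i ≤ b - 1) → π.result R (b - 1) b = b - 1) ∧
      ((¬ π.ChoosesFirst fun i => p i ≤ b - 1) → π.result R (b - 1) b = b) :=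
  result_of_choosesFirst (fun i => (hp i).strict_pred_iff) (fun i => by
    have := (hp i).strict_succ_iff (y := b - 1)
    rw [sub_add_cancel] at this
    rw [this]
    omega) π

theorem result_succ (hp : ∀ i, (R i).IsIdeal (p i)) (π : ProtoDictatorship N) :
    ((π.ChoosesFirst fun i => b + 1 ≤ p i) → π.result R (b + 1) b = b + 1) ∧
      ((¬ π.ChoosesFirst fun i => b + 1 ≤ p i) → π.result R (b + 1) b = b) :=
  result_of_choosesFirst (fun i => (hp i).strict_succ_iff) (fun i => by
    have := (hp i).strict_pred_iff (y := b + 1)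
    rw [add_sub_cancel_right] at this
    rw [this]
    omega) π

end ProtoDictatorship

/-- The right-hand parameters are read off `F`, the left-hand ones off its reflection, with
positions negated. Preferences between adjacent policies depend only on the ideal point, so the
decisions found in `F` are those of arbitrators and proto-dictatorships. -/
theorem isDictatorshipWithSafeguards_of_ospImplementable {N : Type} [Finite N]
    {f : SCF N (singlePeaked Set.univ)} (hu : Unanimous f) (hf : OSPImplementable f) :
    IsDictatorshipWithSafeguards f := by
  classical
  set F : (N → ℤ) → ℤ := fun p => f (rightProfile p) with hFdef
  have hF : IsObviousCutRule F := hf.isObviousCutRule hu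
  obtain ⟨d, x, hd, hd'⟩ := hF.exists_dictator
  obtain ⟨r, ar, hr, har, hright⟩ := hF.exists_right_safeguards hd hd'
  obtain ⟨l, al, hl, hal, hleft⟩ := hF.reflect.exists_right_safeguards (d := d) (x := -x)
    (fun t p ht hp => by have := hd' (-t - 1) (fun i => -p i) (by omega) (by omega); omega)
    (fun t p ht hp => by have := hd (-t - 1) (fun i => -p i) (by omega) (by omega); omega)
  have htop : ∀ (o : Option ℤ) (k : ℤ),
      o.elim ⊤ (fun k => (k : WithTop ℤ)) = (k : WithTop ℤ) ↔ o = some k := by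
    rintro (_ | m) k <;> simp
  have hbot : ∀ (o : Option ℤ) (k : ℤ),
      o.elim ⊥ (fun k => ((-k : ℤ) : WithBot ℤ)) = (k : WithBot ℤ) ↔ o = some (-k) := by
    rintro (_ | m) k
    · simp
    · simp only [Option.elim_some, WithBot.coe_inj, Option.some.injEq]; omega
  let s : SafeguardedDictatorship N :=
    { dictator := d
      left := fun i => (l i).elim ⊥ fun k => ((-k : ℤ) : WithBot ℤ)
      right := fun i => (r i).elim ⊤ fun k => (k : WithTop ℤ)
      center := x
      left_le := fun i _ => by
        rcases h : l i with _ | k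
        · simp
        · have := hl i k h
          simp only [Option.elim_some, WithBot.coe_le_coe]; omega
      le_right := fun i _ => by
        rcases h : r i with _ | k
        · simp
        · have := hr i k h
          simp only [Option.elim_some, WithTop.coe_le_coe]; omega
      arbRight := ar
      arbLeft := fun y => al (-y)
      arbRight_spec := fun y i π h => by
        obtain ⟨h1, h2, h3, h4⟩ := har y i π h
        exact ⟨h1, h2, (htop _ _).2 h3, h4⟩
      arbLeft_spec := fun y i π h => by
        obtain ⟨h1, h2, h3, h4⟩ := hal (-y) i π h
        exact ⟨by omega, h2, (hbot _ _).2 h3, h4⟩ }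
  refine ⟨s, fun R => ?_⟩
  have hex : ∀ i, ∃ q, (R i : Pref ℤ).IsIdeal q := fun i => (R i).2.imp fun _ h => h.2
  choose p hp using hex
  have hfR : f R = F p := hf.eq_of_same_ideals hu hp fun i => Pref.isIdeal_rightLexi (p i)
  have hp' : ∀ i, ((fun i => (R i : Pref ℤ)) i).IsIdeal (p i) := hp
  rw [hfR]
  rcases le_total x (p d) with hpd | hpd
  · obtain ⟨b, hxb, hbd, hb, hlast, hres⟩ := hright p hpd
    refine ⟨b, s.isBest_of_right hp' ((s.mem_approved_iff hp').2 fun i hi =>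
      ⟨fun k hk => ?_, fun k hk => hb i hi k ((htop _ _).1 hk)⟩) hbd ?_, ?_⟩
    · have := hl i _ ((hbot _ _).1 hk)
      omega
    · exact hlast.imp_right fun ⟨i, hi, k, hk, hkb⟩ => ⟨i, hi, k, (htop _ _).2 hk, hkb⟩
    · rcases hres with ⟨hFp, i, π, ha, hpi, hπ⟩ | ⟨hFp, hno⟩
      · rw [(s.arbitrate_of_arbRight ha hp').1 hpi, (π.result_pred hp').1 hπ, hFp]
      · rcases ha : s.arbRight b with _ | ⟨i, π⟩
        · rw [s.arbitrate_of_none ha (s.arbLeft_eq_none hxb), hFp]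
        · by_cases hpi : p i ≤ b - 1
          · rw [(s.arbitrate_of_arbRight ha hp').1 hpi, (π.result_pred hp').2 (hno i π ha hpi), hFp]
          · rw [(s.arbitrate_of_arbRight ha hp').2 (by omega), hFp]
  · obtain ⟨b, hxb, hbd, hb, hlast, hres⟩ := hleft (fun i => -p i) (by omega)
    simp only [neg_neg] at hres
    change (-F p = _ ∧ _) ∨ (-F p = _ ∧ _) at hres
    have hπiff : ∀ π : ProtoDictatorship N, (π.ChoosesFirst fun j => -p j ≤ b - 1) ↔
        π.ChoosesFirst fun j => -b + 1 ≤ p j :=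
      fun π => ProtoDictatorship.choosesFirst_congr fun j => by omega
    have hal' : s.arbLeft (-b) = al b := by simp only [s, neg_neg]
    refine ⟨-b, s.isBest_of_left hp' ((s.mem_approved_iff hp').2 fun i hi =>
      ⟨fun k hk => ?_, fun k hk => ?_⟩) (by change p d ≤ -b; omega) ?_, ?_⟩
    · have := hb i hi _ ((hbot _ _).1 hk)
      omega
    · have := hr i _ ((htop _ _).1 hk)
      omega
    · refine hlast.imp (fun h => by change -b = p d; omega) fun ⟨i, hi, k, hk, hkb⟩ =>
        ⟨i, hi, -k, (hbot _ _).2 (by rwa [neg_neg]), by omega⟩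
    · rcases hres with ⟨hFp, i, π, ha, hpi, hπ⟩ | ⟨hFp, hno⟩
      · rw [← hal'] at ha
        rw [(s.arbitrate_of_arbLeft ha hp').1 (by omega),
          (π.result_succ hp').1 ((hπiff π).1 hπ)]
        omega
      · rcases ha : s.arbLeft (-b) with _ | ⟨i, π⟩
        · rw [s.arbitrate_of_none (s.arbRight_eq_none (by change -b ≤ x; omega)) ha]
          omega
        · by_cases hpi : -b + 1 ≤ p i
          · rw [(s.arbitrate_of_arbLeft ha hp').1 hpi, (π.result_succ hp').2
              ((hπiff π).not.1 (hno i π (hal' ▸ ha) (by omega)))]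
            omega
          · rw [(s.arbitrate_of_arbLeft ha hp').2 (by omega)]
            omega

/-! ### Binary games of perfect information -/

/-- A game of perfect information with two actions at each decision node, given by its states;
`move s = none` where the game ends. -/
structure Automaton (N Y σ : Type) where
  init : σ
  player : σ → N
  move : σ → Option (Bool → σ)
  out : σ → Y
  limit : (ℕ → σ) → Y

namespace Automaton

variable {N Y σ : Type} (A : Automaton N Y σ)

/-- The state after a sequence of actions, if they are available. -/
def run (h : List Bool) : Option σ :=
  h.foldl (fun o a => o.bind fun s => (A.move s).map fun m => m a) (some A.init)

theorem run_nil : A.run [] = some A.init := rfl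

theorem run_concat (h : List Bool) (a : Bool) :
    A.run (h ++ [a]) = (A.run h).bind fun s => (A.move s).map fun m => m a := by
  simp [run]

/-- The extensive form of the game. -/
abbrev toMechanism : Mechanism N Y where
  Act := Bool
  hist := {h | (A.run h).isSome}
  nil_mem := rfl
  init_mem h a ha := by
    change (A.run h).isSome
    replace ha : (A.run (h ++ [a])).isSome := ha
    rw [run_concat] at ha
    cases hr : A.run h
    · simp [hr] at ha
    · rfl
  player h := A.player ((A.run h).getD A.init)
  info := ⊥
  info_player h h' _ _ e := by rw [show h = h' from e]
  info_actions h h' _ _ e a := by rw [show h = h' from e]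
  outcome h := A.out ((A.run h).getD A.init)
  limitOutcome z := A.limit fun k => (A.run ((List.range k).map z)).getD A.init

theorem nonterminal_iff {h : List Bool} :
    A.toMechanism.Nonterminal h ↔ ∃ s m, A.run h = some s ∧ A.move s = some m := by
  constructor
  · rintro ⟨a, ha⟩
    replace ha : (A.run (h ++ [a])).isSome := ha
    rw [run_concat] at ha
    rcases hr : A.run h with _ | s
    · simp [hr] at ha
    · rcases hm : A.move s with _ | m
      · simp [hr, hm] at ha
      · exact ⟨s, m, rfl, hm⟩
  · rintro ⟨s, m, hr, hm⟩
    refine ⟨true, ?_⟩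
    change (A.run (h ++ [true])).isSome
    rw [run_concat, hr]
    simp [hm]

/-- The behavior that acts according to the current state. -/
def behavior (i : N) (c : σ → Bool) : A.toMechanism.Behavior i where
  act h := c ((A.run h).getD A.init)
  mem h hn _ := by
    obtain ⟨s, m, hr, hm⟩ := A.nonterminal_iff.1 hn
    change (A.run (h ++ [_])).isSome
    rw [run_concat, hr]
    simp [hm]
  measurable h h' _ _ _ _ e := by rw [show h = h' from e]

variable {A} {B : ∀ i, A.toMechanism.Behavior i}

theorem next_eq {i : N} {c : σ → Bool} (hB : B i = A.behavior i c) {h : List Bool} {s : σ}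
    (hs : A.run h = some s) (hi : A.player s = i) : Mechanism.next B h = c s := by
  have hp : A.toMechanism.player h = i := by
    change A.player ((A.run h).getD A.init) = i
    rw [hs, Option.getD_some, hi]
  subst hp
  rw [Mechanism.next, hB]
  change c ((A.run h).getD A.init) = _
  rw [hs, Option.getD_some]

theorem run_play_succ {k : ℕ} {s : σ} {m : Bool → σ}
    (hs : A.run (Mechanism.play B k) = some s) (hm : A.move s = some m) :
    A.run (Mechanism.play B (k + 1)) = some (m (Mechanism.next B (Mechanism.play B k))) := by
  rw [Mechanism.play_succ_of_nonterminal (A.nonterminal_iff.2 ⟨s, m, hs, hm⟩)]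
  exact (A.run_concat _ _).trans (by rw [hs]; simp [hm])

theorem exists_run_play (k : ℕ) : ∃ s, A.run (Mechanism.play B k) = some s := by
  induction k with
  | zero => exact ⟨_, rfl⟩
  | succ k ih =>
    obtain ⟨s, hs⟩ := ih
    rcases hm : A.move s with _ | m
    · refine ⟨s, ?_⟩
      rwa [Mechanism.play_succ_of_terminal]
      rw [A.nonterminal_iff]
      rintro ⟨s', m', hs', hm'⟩
      rw [hs] at hs'
      cases hs'
      rw [hm] at hm'
      cases hm'
    · exact ⟨_, run_play_succ hs hm⟩

/-- Moves from states with the property `Q` keep it, at least those in accordance with `B`. -/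
def Preserves (B : ∀ i, A.toMechanism.Behavior i) (Q : σ → Prop) : Prop :=
  ∀ h s m, A.run h = some s → A.move s = some m → Q s → Q (m (Mechanism.next B h))

theorem preserved {Q : σ → Prop} (hpres : Preserves B Q) {k₀ : ℕ} {s₀ : σ}
    (hs₀ : A.run (Mechanism.play B k₀) = some s₀) (hQ : Q s₀) {k : ℕ} (hk : k₀ ≤ k) {s : σ}
    (hs : A.run (Mechanism.play B k) = some s) : Q s := by
  induction k, hk using Nat.le_induction generalizing s with
  | base =>
    rw [hs₀] at hs
    cases hs
    exact hQ
  | succ k hk ih =>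
    obtain ⟨s', hs'⟩ := exists_run_play (B := B) k
    rcases hm : A.move s' with _ | m
    · rw [Mechanism.play_succ_of_terminal] at hs
      · exact ih hs
      · rw [A.nonterminal_iff]
        rintro ⟨s'', m', hs'', hm'⟩
        rw [hs'] at hs''
        cases hs''
        rw [hm] at hm'
        cases hm'
    · rw [run_play_succ hs' hm] at hs
      cases hs
      exact hpres _ _ _ hs' hm (ih hs')

theorem play_eq_map_range (hB : ∀ k, A.toMechanism.Nonterminal (Mechanism.play B k)) (k : ℕ) :
    Mechanism.play B k = (List.range k).map fun k => Mechanism.next B (Mechanism.play B k) := by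
  induction k with
  | zero => rfl
  | succ k ih =>
    rw [Mechanism.play_succ_of_nonterminal (hB k), List.range_succ, List.map_append, ← ih]
    rfl

/-- The result is the outcome of a terminal state with any preserved property, or the limit of
states with this property. -/
theorem result_cases {Q : σ → Prop} (hpres : Preserves B Q) {k₀ : ℕ} {s₀ : σ}
    (hs₀ : A.run (Mechanism.play B k₀) = some s₀) (hQ : Q s₀) :
    (∃ s, Q s ∧ A.move s = none ∧ Mechanism.result B = A.out s) ∨
    ∃ st : ℕ → σ, (∀ k, k₀ ≤ k → Q (st k)) ∧ (∀ k, ∃ h m, A.run h = some (st k) ∧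
      A.move (st k) = some m ∧ st (k + 1) = m (Mechanism.next B h)) ∧
      Mechanism.result B = A.limit st := by
  classical
  by_cases hB : ∃ k, ¬ A.toMechanism.Nonterminal (Mechanism.play B k)
  · left
    have hstay : ∀ k, Nat.find hB ≤ k → Mechanism.play B k = Mechanism.play B (Nat.find hB) := by
      intro k hk
      induction k, hk using Nat.le_induction with
      | base => rfl
      | succ k hk ih =>
        rw [Mechanism.play_succ_of_terminal, ih]
        rw [ih]
        exact Nat.find_spec hB
    obtain ⟨s, hs⟩ := exists_run_play (B := B) (Nat.find hB)
    refine ⟨s, ?_, ?_, ?_⟩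
    · exact preserved hpres hs₀ hQ (le_max_left k₀ (Nat.find hB))
        (by rw [hstay _ (le_max_right _ _), hs])
    · by_contra hm
      obtain ⟨m, hm⟩ := Option.ne_none_iff_exists'.1 hm
      exact Nat.find_spec hB (A.nonterminal_iff.2 ⟨s, m, hs, hm⟩)
    · rw [Mechanism.result, dif_pos hB]
      change A.out ((A.run _).getD A.init) = _
      rw [hs, Option.getD_some]
  · right
    push Not at hB
    choose st hst using exists_run_play (A := A) (B := B)
    refine ⟨st, fun k hk => preserved hpres hs₀ hQ hk (hst k), fun k => ?_, ?_⟩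
    · obtain ⟨s, m, hs, hm⟩ := A.nonterminal_iff.1 (hB k)
      rw [hst k] at hs
      cases hs
      refine ⟨_, m, hst k, hm, ?_⟩
      have := run_play_succ (hst k) hm
      rw [hst (k + 1)] at this
      exact Option.some_injective _ this
    · rw [Mechanism.result, dif_neg (by push Not; exact hB)]
      change A.limit (fun k => (A.run _).getD A.init) = _
      congr 1
      funext k
      rw [← play_eq_map_range hB, hst k, Option.getD_some]

/-- If moreover the moves decrease a rank, then a terminal state is reached. -/
theorem result_of_rank {Q : σ → Prop} (hpres : Preserves B Q) {k₀ : ℕ} {s₀ : σ}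
    (hs₀ : A.run (Mechanism.play B k₀) = some s₀) (hQ : Q s₀) (μ : σ → ℕ ×ₗ ℕ)
    (hμ : ∀ h s m, A.run h = some s → A.move s = some m → Q s → μ (m (Mechanism.next B h)) < μ s) :
    ∃ s, Q s ∧ A.move s = none ∧ Mechanism.result B = A.out s := by
  rcases result_cases hpres hs₀ hQ with h | ⟨st, hst, hmove, -⟩
  · exact h
  · exfalso
    obtain ⟨_, ⟨k, rfl⟩, hmin⟩ := wellFounded_lt.has_min (Set.range fun k => μ (st (k₀ + k)))
      ⟨_, 0, rfl⟩
    obtain ⟨h, m, h1, h2, h3⟩ := hmove (k₀ + k)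
    apply hmin (μ (st (k₀ + (k + 1)))) ⟨k + 1, rfl⟩
    rw [← Nat.add_assoc, h3]
    exact hμ h _ m h1 h2 (hst _ (Nat.le_add_right _ _))

/-- To implement `f` it suffices that states and their players' preferences determine the actions
in such a way that after a deviation nothing is better than what may happen without. -/
theorem ospImplementable {ℛ : Set (Pref Y)} {f : SCF N ℛ} (A : Automaton N Y σ) (c : ℛ → σ → Bool)
    (reach : N → ℛ → σ → Prop)
    (hinit : ∀ i R, reach i R A.init)
    (hreach : ∀ i R s m a, A.move s = some m → reach i R s → (A.player s = i → a = c R s) →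
      reach i R (m a))
    (hobv : ∀ i R s m, A.move s = some m → reach i R s → A.player s = i →
      ∀ (B B' : ∀ j, A.toMechanism.Behavior j) k k', B i = A.behavior i (c R) →
        A.run (Mechanism.play B k) = some (m (c R s)) →
        A.run (Mechanism.play B' k') = some (m (!c R s)) →
        (R : Pref Y).rel (Mechanism.result B) (Mechanism.result B'))
    (hres : ∀ R : N → ℛ, Mechanism.result (fun i => A.behavior i (c (R i))) = f R) :
    OSPImplementable f := by
  classical
  refine ⟨A.toMechanism, fun i R => A.behavior i (c R), ?_, hres⟩
  rintro i R B B' h h' hn - ⟨k, hk⟩ ⟨k', hk'⟩ hi - e hne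
  -- Information sets are singletons, so a deviation happens in the same state; with two actions it
  -- is the opposite one.
  obtain rfl : h = h' := e
  obtain ⟨s, m, hs, hm⟩ := A.nonterminal_iff.1 hn
  have hsi : A.player s = i := by
    rw [← hi]
    change _ = A.player ((A.run h).getD A.init)
    rw [hs, Option.getD_some]
  have hBi : Function.update B i (A.behavior i (c R)) i = A.behavior i (c R) := Function.update_self ..
  have hpres : Preserves (Function.update B i (A.behavior i (c R))) (reach i R) := by
    intro h s m hs hm hr
    exact hreach i R s m _ hm hr fun hi => next_eq hBi hs hi
  have hr : reach i R s := preserved hpres (k₀ := 0) A.run_nil (hinit i R) (Nat.zero_le k) (by rw [hk, hs])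
  have hact : (A.behavior i (c R)).act h = c R s := by
    change c R ((A.run h).getD A.init) = _
    rw [hs, Option.getD_some]
  refine hobv i R s m hm hr hsi _ B' (k + 1) (k' + 1) hBi ?_ ?_
  · rw [run_play_succ (by rw [hk, hs]) hm, hk, next_eq hBi hs hsi]
  · rw [run_play_succ (by rw [hk', hs]) hm, hk', Mechanism.next]
    subst hi
    congr 2
    rw [hact] at hne
    exact Bool.eq_not.2 (Ne.symm hne)

end Automaton

/-! ### Sides and distances from the center -/

namespace SafeguardedDictatorship

variable {N : Type} (s : SafeguardedDictatorship N)

/-- The policy at distance `k` from the center, to the right (`true`) or to the left (`false`). -/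
def pos (ε : Bool) (k : ℤ) : ℤ := if ε then s.center + k else s.center - k

/-- The signed distance of `p` from the center. -/
def dist (ε : Bool) (p : ℤ) : ℤ := if ε then p - s.center else s.center - p

/-- Agent `i` may block policies further away than `k` from the center. -/
def Bound (ε : Bool) (i : N) (k : ℤ) : Prop :=
  if ε then s.right i ≤ ((s.center + k : ℤ) : WithTop ℤ) else ((s.center - k : ℤ) : WithBot ℤ) ≤ s.left i

/-- The arbitrator at distance `k` from the center and the proto-dictatorship. -/
def arb (ε : Bool) (k : ℤ) : Option (N × ProtoDictatorship N) :=
  if ε then s.arbRight (s.center + k) else s.arbLeft (s.center - k)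

variable {s} {ε : Bool} {R : Pref ℤ} {p : ℤ} {i : N} {j k : ℤ}

/-- Preferences are single peaked in the signed distance as well, with a possibly negative peak;
this lets one argument serve both sides. -/
theorem rel_pos_of_ge (hR : R.IsIdeal p) (hj : s.dist ε p ≤ j) (hk : j ≤ k) :
    R.rel (s.pos ε j) (s.pos ε k) := by
  cases ε <;> simp only [pos, dist] at *
  · exact hR.rel_left (by simp; omega) (by simp at *; omega)
  · exact hR.rel_right (by simp at *; omega) (by simp; omega)

theorem rel_pos_of_le (hR : R.IsIdeal p) (hj : j ≤ s.dist ε p) (hk : k ≤ j) :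
    R.rel (s.pos ε j) (s.pos ε k) := by
  cases ε <;> simp only [pos, dist] at *
  · exact hR.rel_right (by simp at *; omega) (by simp; omega)
  · exact hR.rel_left (by simp; omega) (by simp at *; omega)

theorem pos_dist : s.pos ε (s.dist ε p) = p := by
  cases ε <;> simp [pos, dist]

theorem pos_zero : s.pos ε 0 = s.center := by
  cases ε <;> simp [pos]

theorem Bound.mono (h : s.Bound ε i j) (hjk : j ≤ k) : s.Bound ε i k := by
  cases ε <;> simp only [Bound, Bool.false_eq_true, if_true, if_false] at *
  · exact (WithBot.coe_le_coe.2 (by omega)).trans h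
  · exact h.trans (WithTop.coe_le_coe.2 (by omega))

theorem Bound.nonneg (h : s.Bound ε i k) (hi : i ≠ s.dictator) : 0 ≤ k := by
  cases ε <;> simp only [Bound, Bool.false_eq_true, if_true, if_false] at *
  · have := WithBot.coe_le_coe.1 (h.trans (s.left_le i hi))
    omega
  · have := WithTop.coe_le_coe.1 ((s.le_right i hi).trans h)
    omega

theorem arb_spec {π : ProtoDictatorship N} (h : s.arb ε k = some (i, π)) :
    0 < k ∧ i ≠ s.dictator ∧ s.Bound ε i k ∧ ¬ s.Bound ε i (k - 1) := by
  cases ε <;> simp only [Bound, arb, Bool.false_eq_true, if_true, if_false] at *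
  · obtain ⟨h1, h2, h3, -⟩ := s.arbLeft_spec _ _ _ h
    rw [h3, WithBot.coe_le_coe, WithBot.coe_le_coe]
    exact ⟨by omega, h2, by omega, by omega⟩
  · obtain ⟨h1, h2, h3, -⟩ := s.arbRight_spec _ _ _ h
    rw [h3, WithTop.coe_le_coe, WithTop.coe_le_coe]
    exact ⟨by omega, h2, by omega, by omega⟩

theorem arb_zero : s.arb ε 0 = none := by
  rcases h : s.arb ε 0 with _ | ⟨i, π⟩
  · rfl
  · exact absurd (arb_spec h).1 (lt_irrefl 0)

theorem bound_cases (h : s.Bound ε i k) (h' : ¬ s.Bound ε i (k - 1)) :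
    if ε then s.right i = ((s.center + k : ℤ) : WithTop ℤ)
    else s.left i = ((s.center - k : ℤ) : WithBot ℤ) := by
  cases ε <;> simp only [Bound, Bool.false_eq_true, if_true, if_false] at *
  · cases hl : s.left i using WithBot.recBotCoe with
    | bot =>
      rw [hl] at h
      exact absurd h (WithBot.not_coe_le_bot _)
    | coe m =>
      rw [hl, WithBot.coe_le_coe] at h h'
      rw [WithBot.coe_inj]
      omega
  · cases hl : s.right i using WithTop.recTopCoe with
    | top =>
      rw [hl] at h
      exact absurd h (WithTop.not_top_le_coe _)
    | coe m =>
      rw [hl, WithTop.coe_le_coe] at h h'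
      rw [WithTop.coe_inj]
      omega

variable (s) in
-- By monotonicity an agent has at most one threshold on each side, so there are finitely many. `L`
-- will be the distance assigned to unending plays.
theorem exists_far [Finite N] : ∃ L : ℤ, 0 ≤ L ∧
    ∀ ε i k, s.Bound ε i k → ¬ s.Bound ε i (k - 1) → k ≤ L := by
  have hfin : (⋃ (ε : Bool) (i : N), {k | s.Bound ε i k ∧ ¬ s.Bound ε i (k - 1)}).Finite := by
    refine Set.finite_iUnion fun ε => Set.finite_iUnion fun i => Set.Subsingleton.finite ?_
    rintro k ⟨h1, h2⟩ l ⟨h3, h4⟩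
    by_contra hne
    rcases lt_or_gt_of_ne hne with h | h
    · exact h4 (h1.mono (by omega))
    · exact h2 (h3.mono (by omega))
  obtain ⟨L, hL⟩ := hfin.bddAbove
  refine ⟨max 0 L, le_max_left _ _, fun ε i k h1 h2 => le_max_of_le_right (hL ?_)⟩
  exact Set.mem_iUnion.2 ⟨ε, Set.mem_iUnion.2 ⟨i, h1, h2⟩⟩

section Profile

variable {R : N → Pref ℤ} {p : N → ℤ}

/-- Two best policies cannot lie on the same side of the dictator's ideal point. If they enclose it,
it is approved too, and strictly better. -/
theorem isBest_approved_unique (hp : ∀ i, (R i).IsIdeal (p i)) {b b' : ℤ}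
    (h : (R s.dictator).IsBest (s.approved R) b) (h' : (R s.dictator).IsBest (s.approved R) b') :
    b = b' := by
  wlog hlt : b < b' generalizing b b'
  · rcases lt_trichotomy b b' with h1 | h1 | h1
    · exact absurd h1 hlt
    · exact h1
    · exact (this h' h h1).symm
  exfalso
  have hd := hp s.dictator
  rcases le_total (p s.dictator) b with h1 | h1
  · exact (hd.1 _ _ h1 hlt).2 (h'.2 _ h.1)
  rcases le_total b' (p s.dictator) with h2 | h2
  · exact (hd.2 _ _ hlt h2).2 (h.2 _ h'.1)
  have hmem : p s.dictator ∈ s.approved R := by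
    rw [s.mem_approved_iff hp]
    intro i hi
    exact ⟨fun k hk => (((s.mem_approved_iff hp).1 h.1 i hi).1 k hk).trans h1,
      fun k hk => h2.trans (((s.mem_approved_iff hp).1 h'.1 i hi).2 k hk)⟩
  have e1 := hd.eq_of_rel (h.2 _ hmem)
  have e2 := hd.eq_of_rel (h'.2 _ hmem)
  omega

/-- The hypotheses are what is known when truthful play stops at distance `k`: it has not passed the
dictator's ideal, nobody wished to block earlier, and somebody stops now. -/
theorem isBest_pos (hp : ∀ i, (R i).IsIdeal (p i)) (hk : 0 ≤ k)
    (hd : k ≤ s.dist ε (p s.dictator))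
    (hb : ∀ i, i ≠ s.dictator → s.Bound ε i (k - 1) → k ≤ s.dist ε (p i))
    (h : s.dist ε (p s.dictator) ≤ k ∨
      ∃ i, i ≠ s.dictator ∧ s.Bound ε i k ∧ s.dist ε (p i) ≤ k) :
    (R s.dictator).IsBest (s.approved R) (s.pos ε k) := by
  -- The center respects all bounds, and moving outward keeps those of the opposite side.
  have hc := (s.mem_approved_iff hp).1 (s.center_mem_approved hp)
  have hlast : s.dist ε (p s.dictator) ≤ k ∨ ∃ i, i ≠ s.dictator ∧ ∃ m, s.Bound ε i m ∧
      ¬ s.Bound ε i (m - 1) ∧ m ≤ k ∧ s.dist ε (p i) ≤ k := by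
    refine h.imp_right fun ⟨i, hi, hik, hpi⟩ => ⟨i, hi, ?_⟩
    obtain ⟨m, hm, hmin⟩ := Int.exists_least_of_bdd (P := s.Bound ε i) ⟨0, fun _ h => h.nonneg hi⟩
      ⟨k, hik⟩
    exact ⟨m, hm, fun h => by have := hmin _ h; omega, hmin _ hik, hpi⟩
  cases ε
  · simp only [pos, dist, Bool.false_eq_true, if_false] at *
    refine s.isBest_of_left hp ((s.mem_approved_iff hp).2 fun i hi =>
      ⟨fun m hm => ?_, fun m hm => ?_⟩) (by omega) ?_
    · by_cases hbi : s.Bound false i (k - 1)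
      · have := hb i hi hbi
        omega
      · simp only [Bound, Bool.false_eq_true, if_false, hm, WithBot.coe_le_coe] at hbi
        omega
    · have := (hc i hi).2 m hm
      omega
    · refine hlast.imp (fun h => by omega) fun ⟨i, hi, m, h1, h2, h3, h4⟩ => ?_
      have := bound_cases h1 h2
      simp only [Bool.false_eq_true, if_false] at this
      exact ⟨i, hi, _, this, by omega⟩
  · simp only [pos, dist, if_true] at *
    refine s.isBest_of_right hp ((s.mem_approved_iff hp).2 fun i hi =>
      ⟨fun m hm => ?_, fun m hm => ?_⟩) (by omega) ?_
    · have := (hc i hi).1 m hm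
      omega
    · by_cases hbi : s.Bound true i (k - 1)
      · have := hb i hi hbi
        omega
      · simp only [Bound, if_true, hm, WithTop.coe_le_coe] at hbi
        omega
    · refine hlast.imp (fun h => by omega) fun ⟨i, hi, m, h1, h2, h3, h4⟩ => ?_
      have := bound_cases h1 h2
      simp only [if_true] at this
      exact ⟨i, hi, _, this, by omega⟩

theorem arbitrate_pos_of_none (hk : 0 ≤ k) (h : s.arb ε k = none) :
    s.arbitrate R (s.pos ε k) = s.pos ε k := by
  cases ε <;> simp only [pos, arb, Bool.false_eq_true, if_true, if_false] at *
  · exact s.arbitrate_of_none (s.arbRight_eq_none (by omega)) h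
  · exact s.arbitrate_of_none h (s.arbLeft_eq_none (by omega))

theorem arbitrate_pos_of_arb (hp : ∀ i, (R i).IsIdeal (p i)) {π : ProtoDictatorship N}
    (h : s.arb ε k = some (i, π)) :
    (s.dist ε (p i) < k → s.arbitrate R (s.pos ε k) = π.result R (s.pos ε (k - 1)) (s.pos ε k)) ∧
      (k ≤ s.dist ε (p i) → s.arbitrate R (s.pos ε k) = s.pos ε k) := by
  cases ε <;> simp only [pos, arb, dist, Bool.false_eq_true, if_true, if_false] at *
  · have := s.arbitrate_of_arbLeft h hp
    rw [show s.center - (k - 1) = s.center - k + 1 by ring]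
    exact ⟨fun h => this.1 (by omega), fun h => this.2 (by omega)⟩
  · have := s.arbitrate_of_arbRight h hp
    rw [show s.center + (k - 1) = s.center + k - 1 by ring]
    exact ⟨fun h => this.1 (by omega), fun h => this.2 (by omega)⟩

end Profile

end SafeguardedDictatorship

/-! ### The game that implements a safeguarded dictatorship -/

namespace SafeguardedDictatorship

/-- The states of the game: the dictator first chooses a side; at distance `k` from the center on
the side `ε` the arbitrator, if any, may start the proto-dictatorship, then a list of agents may
stop, and finally the dictator stops or moves on. -/
inductive State (N : Type) where
  | start
  | right_declined
  | arb (ε : Bool) (k : ℤ) (i : N) (π : ProtoDictatorship N)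
  | ask (ε : Bool) (k : ℤ) (l : List N)
  | proto (ε : Bool) (k : ℤ) (π : ProtoDictatorship N)
  | done (y : ℤ)

variable {N : Type} (s : SafeguardedDictatorship N)

/-- The choice of the side `ε` has been made. -/
def State.OnSide (ε : Bool) : State N → Prop
  | .arb ε' .. => ε' = ε
  | .ask ε' .. => ε' = ε
  | .proto ε' .. => ε' = ε
  | _ => False

open Classical in
/-- The agents, other than the dictator, who may stop at distance `k`. -/
noncomputable def blockers [Fintype N] (ε : Bool) (k : ℤ) : List N :=
  (Finset.univ.filter fun i => i ≠ s.dictator ∧ s.Bound ε i k).toList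

/-- The first state at distance `k`. -/
noncomputable def enter [Fintype N] (ε : Bool) (k : ℤ) : State N :=
  match s.arb ε k with
  | some (i, π) => .arb ε k i π
  | none => .ask ε k (s.blockers ε k)

/-- The player moving in a state. -/
def player : State N → N
  | .arb _ _ i _ => i
  | .ask _ _ (i :: _) => i
  | .proto _ _ (.last i) => i
  | .proto _ _ (.offer i _ _) => i
  | _ => s.dictator

/-- The moves in a state. -/
noncomputable def move [Fintype N] : State N → Option (Bool → State N)
  | .start => some fun a => if a then s.enter true 0 else .right_declined
  | .right_declined => some fun a => if a then s.enter false 0 else .done s.center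
  | .arb ε k _ π => some fun a => if a then .proto ε k π else .ask ε k (s.blockers ε k)
  | .ask ε k (_ :: l) => some fun a => if a then .done (s.pos ε k) else .ask ε k l
  | .ask ε k [] => some fun a => if a then .done (s.pos ε k) else s.enter ε (k + 1)
  | .proto ε k (.last _) => some fun a => .done (if a then s.pos ε (k - 1) else s.pos ε k)
  | .proto ε k (.offer _ b π) => some fun a =>
      if a then .done (if b then s.pos ε (k - 1) else s.pos ε k) else .proto ε k π
  | .done _ => none

open Classical in
/-- The action taken by an agent with preference `R` and ideal point `p`. -/
noncomputable def choice (p : ℤ) (R : Pref ℤ) : State N → Bool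
  | .start => decide (s.center < p)
  | .right_declined => decide (p < s.center)
  | .arb ε k _ _ => decide (s.dist ε p < k)
  | .ask ε k _ => decide (s.dist ε p ≤ k)
  | .proto ε k (.last _) => decide (R.strict (s.pos ε (k - 1)) (s.pos ε k))
  | .proto ε k (.offer _ true _) => decide (R.strict (s.pos ε (k - 1)) (s.pos ε k))
  | .proto ε k (.offer _ false _) => decide (R.strict (s.pos ε k) (s.pos ε (k - 1)))
  | .done _ => true

open Classical in
/-- The game, where going on forever leads to a policy at distance `L`. -/
noncomputable def automaton [Fintype N] (L : ℤ) : Automaton N ℤ (State N) where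
  init := .start
  player := s.player
  move := s.move
  out t := match t with
    | .done y => y
    -- Only `.done` states are terminal, so this value is never used.
    | _ => s.center
  limit st := if ∃ K, ∀ k, K ≤ k → (st k).OnSide true then s.pos true L else s.pos false L

variable {s} [Fintype N] {L : ℤ} {ε : Bool} {i : N} {k w : ℤ}

theorem mem_blockers : i ∈ s.blockers ε k ↔ i ≠ s.dictator ∧ s.Bound ε i k := by
  classical
  simp [blockers]

theorem enter_cases (P : State N → Prop) (h₁ : ∀ i π, s.arb ε k = some (i, π) → P (.arb ε k i π))
    (h₂ : s.arb ε k = none → P (.ask ε k (s.blockers ε k))) : P (s.enter ε k) := by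
  unfold enter
  rcases h : s.arb ε k with _ | ⟨i, π⟩
  · exact h₂ h
  · exact h₁ i π h

theorem eq_done_of_move_eq_none {t : State N} (h : s.move t = none) : ∃ y, t = .done y := by
  rcases t with _ | _ | _ | ⟨_, _, _ | _⟩ | ⟨_, _, _ | _⟩ | y <;> simp [move] at h
  exact ⟨y, rfl⟩

/-- All outcomes from here are at distance at least `w` on the side `ε`, as is the limit. -/
def State.Beyond (s : SafeguardedDictatorship N) (ε : Bool) (w : ℤ) : State N → Prop
  | .start => False
  | .right_declined => ε = false ∧ w ≤ 0
  | .arb ε' k _ _ => ε' = ε ∧ w ≤ k - 1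
  | .ask ε' k _ => ε' = ε ∧ w ≤ k
  | .proto ε' k _ => ε' = ε ∧ w ≤ k - 1
  | .done y => ∃ j, w ≤ j ∧ y = s.pos ε j

/-- Arbitration at distance `k` may lead back to `k - 1`, hence the proviso for `w = k`. -/
theorem State.Beyond.enter (h : w ≤ k) (hk : w = k → s.arb ε k = none) :
    (s.enter ε k).Beyond s ε w := by
  apply enter_cases
  · intro i π he
    refine ⟨rfl, ?_⟩
    by_contra! hlt
    have := hk (by omega)
    rw [he] at this
    cases this
  · exact fun _ => ⟨rfl, h⟩

theorem State.Beyond.move {t : State N} {m : Bool → State N} (h : t.Beyond s ε w)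
    (hm : s.move t = some m) (a : Bool) : (m a).Beyond s ε w := by
  rcases t with _ | _ | ⟨ε', k, i, π⟩ | ⟨ε', k, _ | ⟨i, l⟩⟩ | ⟨ε', k, i | ⟨i, b, π⟩⟩ | y
  · exact h.elim
  · cases hm
    obtain ⟨rfl, h⟩ := h
    cases a
    · exact ⟨0, h, pos_zero.symm⟩
    · exact State.Beyond.enter h fun _ => arb_zero
  · cases hm
    obtain ⟨rfl, h⟩ := h
    cases a
    · exact ⟨rfl, by omega⟩
    · exact ⟨rfl, h⟩
  · cases hm
    obtain ⟨rfl, h⟩ := h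
    cases a
    · exact State.Beyond.enter (by omega) (by omega)
    · exact ⟨k, h, rfl⟩
  · cases hm
    obtain ⟨rfl, h⟩ := h
    cases a
    · exact ⟨rfl, h⟩
    · exact ⟨k, h, rfl⟩
  · cases hm
    obtain ⟨rfl, h⟩ := h
    cases a
    · exact ⟨k, by omega, rfl⟩
    · exact ⟨k - 1, by omega, rfl⟩
  · cases hm
    obtain ⟨rfl, h⟩ := h
    cases a
    · exact ⟨rfl, h⟩
    · cases b
      · exact ⟨k, by omega, rfl⟩
      · exact ⟨k - 1, by omega, rfl⟩
  · cases hm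

variable {B : ∀ i, (s.automaton L).toMechanism.Behavior i} {K : ℕ} {t : State N}

/-- No agent is assumed to follow a strategy, since every move keeps `Beyond`. Play may go on
forever, which is where `w ≤ L` enters. -/
theorem result_of_beyond (hw : w ≤ L) (hs : (s.automaton L).run (Mechanism.play B K) = some t)
    (ht : t.Beyond s ε w) : ∃ j, w ≤ j ∧ Mechanism.result B = s.pos ε j := by
  classical
  have hpres : Automaton.Preserves B (State.Beyond s ε w) := fun h t m _ hm hb => hb.move hm _
  rcases Automaton.result_cases hpres hs ht with ⟨t', hb, hm, hr⟩ | ⟨st, hst, hmv, hr⟩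
  · obtain ⟨y, rfl⟩ := eq_done_of_move_eq_none hm
    obtain ⟨j, hj, rfl⟩ := hb
    exact ⟨j, hj, hr⟩
  · refine ⟨L, hw, ?_⟩
    rw [hr]
    change (if _ then _ else _) = _
    have hside : ∀ k, K ≤ k → (st k).Beyond s ε w := hst
    cases ε
    · rw [if_neg]
      rintro ⟨K', hK'⟩
      have h1 := hside (max K K') (le_max_left _ _)
      have h2 := hK' (max K K') (le_max_right _ _)
      cases hc : st (max K K') <;> rw [hc] at h1 h2 <;>
        simp_all [State.Beyond, State.OnSide]
    · rw [if_pos]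
      refine ⟨K, fun k hk => ?_⟩
      have h1 := hside k hk
      obtain ⟨_, m, _, h2, _⟩ := hmv k
      cases hc : st k <;> rw [hc] at h1 h2 <;>
        simp_all [State.Beyond, State.OnSide]
      cases h2

/-- The number of remaining agents in a proto-dictatorship. -/
def protoLength : ProtoDictatorship N → ℕ
  | .last _ => 0
  | .offer _ _ π => protoLength π + 1

/-- A rank that decreases along all plays that do not go further from the center than `q`. -/
noncomputable def rank (s : SafeguardedDictatorship N) (q : ℤ) : State N → ℕ ×ₗ ℕ
  -- The invariants used with this rank exclude `.start`. The constants place `.right_declined`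
  -- above distance `0`, and proto-dictatorships below all distances.
  | .start => toLex (0, 0)
  | .right_declined => toLex (q.toNat + 3, 0)
  | .arb ε k _ _ => toLex ((q - k).toNat + 2, (s.blockers ε k).length + 1)
  | .ask _ k l => toLex ((q - k).toNat + 2, l.length)
  | .proto _ _ π => toLex (1, protoLength π)
  | .done _ => toLex (0, 0)

end SafeguardedDictatorship

theorem Pref.rel_of_not_strict {Y : Type} {R : Pref Y} {x y : Y} (h : ¬ R.strict x y) :
    R.rel y x := by
  by_contra hn
  exact h ⟨(R.total x y).resolve_right hn, hn⟩

namespace SafeguardedDictatorship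

variable {N : Type} [Fintype N] {s : SafeguardedDictatorship N} {L : ℤ} {ε : Bool} {i : N}
  {k w p q : ℤ} {R : Pref ℤ} {t : State N} {m : Bool → State N} {a : Bool}

/-- If agent `i` follows her strategy from here, then all outcomes are at distances between `w` and
her ideal distance `q` on the side `ε`. -/
def State.Within (s : SafeguardedDictatorship N) (ε : Bool) (i : N) (w q : ℤ) : State N → Prop
  | .start => False
  | .right_declined => ε = false ∧ i = s.dictator ∧ w ≤ 0 ∧ 0 ≤ q
  | .arb ε' k _ _ => ε' = ε ∧ w ≤ k - 1 ∧ k ≤ q ∧ (i ≠ s.dictator → s.Bound ε i k)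
  | .ask ε' k l => ε' = ε ∧ w ≤ k ∧ k ≤ q ∧ (i ≠ s.dictator → s.Bound ε i k ∧ (k < q ∨ i ∈ l))
  | .proto ε' k _ => ε' = ε ∧ w ≤ k - 1 ∧ k ≤ q
  | .done y => ∃ j, w ≤ j ∧ j ≤ q ∧ y = s.pos ε j

theorem State.Within.enter (h : w ≤ k) (hq : k ≤ q) (hk : w = k → s.arb ε k = none)
    (hi : i ≠ s.dictator → s.Bound ε i k) :
    (s.enter ε k).Within s ε i w q ∧
      ∀ n, s.rank q (s.enter ε k) < toLex ((q - k).toNat + 3, n) := by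
  apply enter_cases (P := fun t => t.Within s ε i w q ∧ ∀ n, s.rank q t < toLex ((q - k).toNat + 3, n))
  · intro j π he
    refine ⟨⟨rfl, ?_, hq, hi⟩, fun n => Prod.Lex.toLex_lt_toLex.2 (Or.inl (Nat.lt_succ_self _))⟩
    by_contra! hlt
    have := hk (by omega)
    rw [he] at this
    cases this
  · exact fun _ => ⟨⟨rfl, h, hq, fun hd => ⟨hi hd, Or.inr (mem_blockers.2 ⟨hd, hi hd⟩)⟩⟩,
      fun n => Prod.Lex.toLex_lt_toLex.2 (Or.inl (Nat.lt_succ_self _))⟩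

/-- An agent following her strategy stops at her ideal distance at the latest: the dictator is asked
at the end of each list, and any other agent covered by the invariant is either short of her ideal
or still on the list. So the rank falls whatever the others do. -/
theorem State.Within.move (h : t.Within s ε i w q) (hq : s.dist ε p = q) (hm : s.move t = some m)
    (ha : s.player t = i → a = s.choice p R t) :
    (m a).Within s ε i w q ∧ s.rank q (m a) < s.rank q t := by
  subst hq
  rcases t with _ | _ | ⟨ε', k, j, π⟩ | ⟨ε', k, _ | ⟨j, l⟩⟩ | ⟨ε', k, j | ⟨j, b, π⟩⟩ | y
  · exact h.elim
  · cases hm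
    obtain ⟨rfl, hi, hw, hq⟩ := h
    cases a
    · exact ⟨⟨0, hw, hq, pos_zero.symm⟩, Prod.Lex.toLex_lt_toLex.2 (Or.inl (by simp))⟩
    · have := State.Within.enter (ε := false) (i := i) hw hq (fun _ => arb_zero) (fun hd => absurd hi hd)
      rw [sub_zero] at this
      exact ⟨this.1, this.2 _⟩
  · cases hm
    obtain ⟨rfl, hw, hq, hi⟩ := h
    cases a
    · exact ⟨⟨rfl, by omega, hq, fun hd => ⟨hi hd, Or.inr (mem_blockers.2 ⟨hd, hi hd⟩)⟩⟩,
        Prod.Lex.toLex_lt_toLex.2 (Or.inr ⟨rfl, Nat.lt_succ_self _⟩)⟩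
    · exact ⟨⟨rfl, hw, hq⟩, Prod.Lex.toLex_lt_toLex.2 (Or.inl (by simp))⟩
  · cases hm
    obtain ⟨rfl, hw, hq, hi⟩ := h
    cases a
    · have hlt : k < s.dist ε' p := by
        by_cases hd : i = s.dictator
        · have := ha hd.symm
          simpa [choice] using this
        · exact (hi hd).2.resolve_right (by simp)
      have := State.Within.enter (s := s) (ε := ε') (i := i) (w := w) (k := k + 1) (by omega) hlt
        (by omega) fun hd => (hi hd).1.mono (by omega)
      refine ⟨this.1, ?_⟩
      have h2 := this.2 0
      rwa [show (s.dist ε' p - (k + 1)).toNat + 3 = (s.dist ε' p - k).toNat + 2 by omega] at h2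
    · exact ⟨⟨k, hw, hq, rfl⟩, Prod.Lex.toLex_lt_toLex.2 (Or.inl (by simp))⟩
  · cases hm
    obtain ⟨rfl, hw, hq, hi⟩ := h
    cases a
    · refine ⟨⟨rfl, hw, hq, fun hd => ⟨(hi hd).1, ?_⟩⟩,
        Prod.Lex.toLex_lt_toLex.2 (Or.inr ⟨rfl, Nat.lt_succ_self _⟩)⟩
      rcases (hi hd).2 with h | h
      · exact Or.inl h
      · rcases List.mem_cons.1 h with rfl | h
        · have := ha rfl
          exact Or.inl (by simpa [choice] using this)
        · exact Or.inr h
    · exact ⟨⟨k, hw, hq, rfl⟩, Prod.Lex.toLex_lt_toLex.2 (Or.inl (by simp))⟩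
  · cases hm
    obtain ⟨rfl, hw, hq⟩ := h
    refine ⟨?_, Prod.Lex.toLex_lt_toLex.2 (Or.inl (by simp))⟩
    cases a
    · exact ⟨k, by omega, hq, rfl⟩
    · exact ⟨k - 1, hw, by omega, rfl⟩
  · cases hm
    obtain ⟨rfl, hw, hq⟩ := h
    cases a
    · exact ⟨⟨rfl, hw, hq⟩, Prod.Lex.toLex_lt_toLex.2 (Or.inr ⟨rfl, Nat.lt_succ_self _⟩)⟩
    · refine ⟨?_, Prod.Lex.toLex_lt_toLex.2 (Or.inl (by simp))⟩
      cases b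
      · exact ⟨k, by omega, hq, rfl⟩
      · exact ⟨k - 1, hw, by omega, rfl⟩
  · cases hm

variable {B : ∀ i, (s.automaton L).toMechanism.Behavior i} {K : ℕ}

theorem result_of_within (hB : B i = (s.automaton L).behavior i (s.choice p R))
    (ht : (s.automaton L).run (Mechanism.play B K) = some t)
    (h : t.Within s ε i w (s.dist ε p)) :
    ∃ j, w ≤ j ∧ j ≤ s.dist ε p ∧ Mechanism.result B = s.pos ε j := by
  have hstep : ∀ h t m, (s.automaton L).run h = some t → (s.automaton L).move t = some m →
      t.Within s ε i w (s.dist ε p) → (m (Mechanism.next B h)).Within s ε i w (s.dist ε p) ∧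
        s.rank (s.dist ε p) (m (Mechanism.next B h)) < s.rank (s.dist ε p) t :=
    fun h t m ht hm hw => hw.move (R := R) rfl hm fun hi => Automaton.next_eq hB ht hi
  obtain ⟨t', hw, hm, hr⟩ := Automaton.result_of_rank (fun h t m a b c => (hstep h t m a b c).1) ht h
    (s.rank (s.dist ε p)) fun h t m a b c => (hstep h t m a b c).2
  obtain ⟨y, rfl⟩ := eq_done_of_move_eq_none hm
  obtain ⟨j, h1, h2, rfl⟩ := hw
  exact ⟨j, h1, h2, hr⟩

theorem result_of_done {y : ℤ}
    (ht : (s.automaton L).run (Mechanism.play B K) = some (.done y)) : Mechanism.result B = y := by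
  obtain ⟨t', rfl, hm, hr⟩ := Automaton.result_of_rank (Q := fun t => t = .done y)
    (by rintro h t m - hm rfl; cases hm) ht rfl (fun _ => toLex (0, 0))
    (by rintro h t m - hm rfl; cases hm)
  exact hr

/-- A proto-dictatorship between the distances `k - 1` and `k` is played, or has been. -/
def State.Arbitrated (s : SafeguardedDictatorship N) (ε : Bool) (k : ℤ) : State N → Prop
  | .proto ε' k' _ => ε' = ε ∧ k' = k
  | .done y => y = s.pos ε (k - 1) ∨ y = s.pos ε k
  | _ => False

theorem result_of_proto {π : ProtoDictatorship N}
    (ht : (s.automaton L).run (Mechanism.play B K) = some (.proto ε k π)) :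
    Mechanism.result B = s.pos ε (k - 1) ∨ Mechanism.result B = s.pos ε k := by
  have hstep : ∀ (t : State N) m a, s.move t = some m → t.Arbitrated s ε k →
      (m a).Arbitrated s ε k ∧ s.rank 0 (m a) < s.rank 0 t := by
    rintro (_ | _ | _ | _ | ⟨ε', k', j | ⟨j, b, π⟩⟩ | y) m a hm h <;> try exact h.elim
    · cases hm
      obtain ⟨rfl, rfl⟩ := h
      refine ⟨?_, Prod.Lex.toLex_lt_toLex.2 (Or.inl (by simp))⟩
      cases a
      · exact Or.inr rfl
      · exact Or.inl rfl
    · cases hm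
      obtain ⟨rfl, rfl⟩ := h
      cases a
      · exact ⟨⟨rfl, rfl⟩, Prod.Lex.toLex_lt_toLex.2 (Or.inr ⟨rfl, Nat.lt_succ_self _⟩)⟩
      · refine ⟨?_, Prod.Lex.toLex_lt_toLex.2 (Or.inl (by simp))⟩
        cases b
        · exact Or.inr rfl
        · exact Or.inl rfl
    · cases hm
  obtain ⟨t', hw, hm, hr⟩ := Automaton.result_of_rank (Q := State.Arbitrated s ε k)
    (fun h t m _ b c => (hstep t m _ b c).1) ht ⟨rfl, rfl⟩ (s.rank 0)
    fun h t m _ b c => (hstep t m _ b c).2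
  obtain ⟨y, rfl⟩ := eq_done_of_move_eq_none hm
  have hr : Mechanism.result B = y := hr
  rw [hr]
  exact hw

/-- The state can be reached if agent `i`, whose ideal point is `p`, follows her strategy. -/
def State.Reached (s : SafeguardedDictatorship N) (i : N) (p : ℤ) : State N → Prop
  | .right_declined => i = s.dictator → p ≤ s.center
  | .arb ε k j π => s.arb ε k = some (j, π) ∧ (i = s.dictator → k ≤ s.dist ε p) ∧
      (i ≠ s.dictator → s.Bound ε i (k - 1) → k ≤ s.dist ε p)
  | .ask ε k l => 0 ≤ k ∧ (∀ j ∈ l, j ≠ s.dictator ∧ s.Bound ε j k) ∧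
      (i = s.dictator → k ≤ s.dist ε p) ∧ (i ≠ s.dictator → (s.Bound ε i (k - 1) → k ≤ s.dist ε p) ∧
        (s.Bound ε i k → k < s.dist ε p ∨ i ∈ l))
  | _ => True

theorem reached_enter (hk : 0 ≤ k) (h₁ : i = s.dictator → k ≤ s.dist ε p)
    (h₂ : i ≠ s.dictator → s.Bound ε i (k - 1) → k ≤ s.dist ε p) :
    (s.enter ε k).Reached s i p := by
  apply enter_cases
  · exact fun j π he => ⟨he, h₁, h₂⟩
  · exact fun _ => ⟨hk, fun j hj => mem_blockers.1 hj, h₁, fun hi => ⟨h₂ hi, fun hb =>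
      Or.inr (mem_blockers.2 ⟨hi, hb⟩)⟩⟩

/-- An agent entitled to block leaves the list without stopping only if her ideal is further away;
so whoever could block before has not yet passed her ideal. -/
theorem State.Reached.move (h : t.Reached s i p) (hm : s.move t = some m)
    (ha : s.player t = i → a = s.choice p R t) : (m a).Reached s i p := by
  rcases t with _ | _ | ⟨ε, k, j, π⟩ | ⟨ε, k, _ | ⟨j, l⟩⟩ | ⟨ε, k, j | ⟨j, b, π⟩⟩ | y
  · cases hm
    cases a
    · intro hi
      simpa [choice] using ha hi.symm
    · refine reached_enter le_rfl (fun hi => ?_) fun hi hb => ?_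
      · have := ha hi.symm
        simp only [choice, true_eq_decide_iff] at this
        simp only [dist, if_true]
        omega
      · have := hb.nonneg hi
        omega
  · cases hm
    cases a
    · trivial
    · refine reached_enter le_rfl (fun hi => ?_) fun hi hb => ?_
      · have := h hi
        simp only [dist, Bool.false_eq_true, if_false]
        omega
      · have := hb.nonneg hi
        omega
  · cases hm
    obtain ⟨he, h1, h2⟩ := h
    cases a
    · exact ⟨(arb_spec he).1.le, fun j hj => mem_blockers.1 hj, h1, fun hi => ⟨h2 hi, fun hb =>
        Or.inr (mem_blockers.2 ⟨hi, hb⟩)⟩⟩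
    · trivial
  · cases hm
    obtain ⟨hk, hl, h1, h2⟩ := h
    cases a
    · refine reached_enter (by omega) (fun hi => ?_) fun hi hb => ?_
      · have := ha hi.symm
        simp only [choice, Bool.false_eq, decide_eq_false_iff_not] at this
        omega
      · rw [add_sub_cancel_right] at hb
        exact ((h2 hi).2 hb).resolve_right (by simp)
    · trivial
  · cases hm
    obtain ⟨hk, hl, h1, h2⟩ := h
    cases a
    · refine ⟨hk, fun j hj => hl j (List.mem_cons_of_mem _ hj), h1, fun hi => ⟨(h2 hi).1, fun hb => ?_⟩⟩
      rcases (h2 hi).2 hb with h | h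
      · exact Or.inl h
      · rcases List.mem_cons.1 h with rfl | h
        · have := ha rfl
          exact Or.inl (by simpa [choice] using this)
        · exact Or.inr h
    · trivial
  · cases hm
    trivial
  · cases hm
    cases a <;> trivial
  · cases hm

/-- Following the strategy is obviously better than deviating from it. -/
theorem rel_result_of_deviation (hL : 0 ≤ L)
    (hfar : ∀ ε i k, s.Bound ε i k → ¬ s.Bound ε i (k - 1) → k ≤ L) (hR : R.IsIdeal p)
    (hm : s.move t = some m) (ht : t.Reached s i p) (hi : s.player t = i)
    {B B' : ∀ i, (s.automaton L).toMechanism.Behavior i} {K K' : ℕ}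
    (hB : B i = (s.automaton L).behavior i (s.choice p R))
    (hK : (s.automaton L).run (Mechanism.play B K) = some (m (s.choice p R t)))
    (hK' : (s.automaton L).run (Mechanism.play B' K') = some (m (!s.choice p R t))) :
    R.rel (Mechanism.result B) (Mechanism.result B') := by
  rcases t with _ | _ | ⟨ε, k, j, π⟩ | ⟨ε, k, _ | ⟨j, l⟩⟩ | ⟨ε, k, j | ⟨j, b, π⟩⟩ | y
  · cases hm
    change s.dictator = i at hi
    -- Following leads between the center and her ideal point, deviating to the center or the other
    -- side.
    by_cases hc : s.center < p
    · have hch : s.choice p R State.start = true := by simp [choice, hc]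
      rw [hch] at hK hK'
      have hd : 0 ≤ s.dist true p := by simp only [dist, if_true]; omega
      obtain ⟨j, h1, h2, hr⟩ := result_of_within hB hK
        (State.Within.enter le_rfl hd (fun _ => arb_zero) fun h => absurd hi.symm h).1
      obtain ⟨j', h1', hr'⟩ := result_of_beyond (ε := false) (w := 0) hL hK' ⟨rfl, le_rfl⟩
      rw [hr, hr']
      simp only [pos, dist, Bool.false_eq_true, if_true, if_false] at *
      exact hR.rel_left (by omega) (by omega)
    · have hch : s.choice p R State.start = false := by simp [choice, hc]
      rw [hch] at hK hK'
      have hd : 0 ≤ s.dist false p := by simp only [dist, Bool.false_eq_true, if_false]; omega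
      obtain ⟨j, h1, h2, hr⟩ := result_of_within (ε := false) (w := 0) hB hK ⟨rfl, hi.symm, le_rfl, hd⟩
      obtain ⟨j', h1', hr'⟩ := result_of_beyond hL hK' (State.Beyond.enter le_rfl fun _ => arb_zero)
      rw [hr, hr']
      simp only [pos, dist, Bool.false_eq_true, if_true, if_false] at *
      exact hR.rel_right (by omega) (by omega)
  · cases hm
    change s.dictator = i at hi
    have hp := ht hi.symm
    by_cases hc : p < s.center
    · have hch : s.choice p R State.right_declined = true := by simp [choice, hc]
      rw [hch] at hK hK'
      have hd : 0 ≤ s.dist false p := by simp only [dist, Bool.false_eq_true, if_false]; omega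
      obtain ⟨j, h1, h2, hr⟩ := result_of_within hB hK
        (State.Within.enter le_rfl hd (fun _ => arb_zero) fun h => absurd hi.symm h).1
      rw [hr, result_of_done hK', ← pos_zero (ε := false)]
      exact rel_pos_of_le hR h2 h1
    · have hch : s.choice p R State.right_declined = false := by simp [choice, hc]
      rw [hch] at hK
      rw [result_of_done hK, show s.center = p by omega]
      exact hR.rel_ideal _
  · cases hm
    change j = i at hi
    subst hi
    obtain ⟨he, -, h2⟩ := ht
    obtain ⟨hk, hd, hb, hb'⟩ := arb_spec he
    -- If her ideal distance is below `k`, arbitration gives `k - 1` or `k`, and declining at least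
    -- `k`. Otherwise declining ends between `k` and her ideal distance, and arbitration gives at
    -- most `k`.
    by_cases hc : s.dist ε p < k
    · have hch : s.choice p R (.arb ε k j π) = true := by simp [choice, hc]
      rw [hch] at hK hK'
      obtain ⟨j', h1', hr'⟩ := result_of_beyond (hfar _ _ _ hb hb') hK' ⟨rfl, le_rfl⟩
      rw [hr']
      rcases result_of_proto hK with hr | hr <;> rw [hr] <;>
        exact rel_pos_of_ge hR (by omega) (by omega)
    · have hch : s.choice p R (.arb ε k j π) = false := by simp [choice, hc]
      rw [hch] at hK hK'
      obtain ⟨j', h1, h2, hr⟩ := result_of_within hB hK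
        ⟨rfl, le_rfl, not_lt.1 hc, fun _ => ⟨hb, Or.inr (mem_blockers.2 ⟨hd, hb⟩)⟩⟩
      rw [hr]
      rcases result_of_proto hK' with hr' | hr' <;> rw [hr'] <;>
        exact rel_pos_of_le hR (by omega) (by omega)
  · cases hm
    change s.dictator = i at hi
    obtain ⟨hk, -, h1, -⟩ := ht
    by_cases hc : s.dist ε p ≤ k
    · have hch : s.choice p R (.ask ε k []) = true := by simp [choice, hc]
      rw [hch] at hK
      have hr : Mechanism.result B = s.pos ε k := result_of_done hK
      rw [hr, show k = s.dist ε p from le_antisymm (h1 hi.symm) hc, pos_dist]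
      exact hR.rel_ideal _
    · have hch : s.choice p R (.ask ε k []) = false := by simp [choice, hc]
      rw [hch] at hK hK'
      obtain ⟨j, h3, h4, hr⟩ := result_of_within (w := k) hB hK
        (State.Within.enter (by omega) (by omega) (by omega) fun h => absurd hi.symm h).1
      have hr' : Mechanism.result B' = s.pos ε k := result_of_done hK'
      rw [hr, hr']
      exact rel_pos_of_le hR h4 h3
  · cases hm
    change j = i at hi
    subst hi
    obtain ⟨hk, hl, -, h2⟩ := ht
    obtain ⟨hd, hb⟩ := hl j List.mem_cons_self
    by_cases hc : s.dist ε p ≤ k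
    · have hch : s.choice p R (.ask ε k (j :: l)) = true := by simp [choice, hc]
      rw [hch] at hK hK'
      have hr : Mechanism.result B = s.pos ε k := result_of_done hK
      -- If she could have stopped earlier, `k` is her ideal distance. If not, `k` is her own
      -- threshold, so `k ≤ L` and even unending plays lead no nearer than `k`.
      by_cases hb' : s.Bound ε j (k - 1)
      · rw [hr, show k = s.dist ε p from le_antisymm ((h2 hd).1 hb') hc, pos_dist]
        exact hR.rel_ideal _
      · obtain ⟨j', h1', hr'⟩ := result_of_beyond (hfar _ _ _ hb hb') hK' ⟨rfl, le_rfl⟩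
        rw [hr, hr']
        exact rel_pos_of_ge hR hc h1'
    · have hch : s.choice p R (.ask ε k (j :: l)) = false := by simp [choice, hc]
      rw [hch] at hK hK'
      obtain ⟨j', h3, h4, hr⟩ := result_of_within (w := k) hB hK
        ⟨rfl, le_rfl, (not_le.1 hc).le, fun _ => ⟨hb, Or.inl (not_le.1 hc)⟩⟩
      have hr' : Mechanism.result B' = s.pos ε k := result_of_done hK'
      rw [hr, hr']
      exact rel_pos_of_le hR h4 h3
  · cases hm
    have hr := result_of_done hK
    have hr' := result_of_done hK'
    rw [hr, hr']
    by_cases hc : R.strict (s.pos ε (k - 1)) (s.pos ε k)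
    · have hch : s.choice p R (.proto ε k (.last j)) = true := by simp [choice, hc]
      rw [hch]
      exact hc.1
    · have hch : s.choice p R (.proto ε k (.last j)) = false := by simp [choice, hc]
      rw [hch]
      exact Pref.rel_of_not_strict hc
  · cases hm
    cases b
    · by_cases hc : R.strict (s.pos ε k) (s.pos ε (k - 1))
      · have hch : s.choice p R (.proto ε k (.offer j false π)) = true := by simp [choice, hc]
        rw [hch] at hK hK'
        have hr : Mechanism.result B = s.pos ε k := result_of_done hK
        rcases result_of_proto hK' with hr' | hr' <;> rw [hr, hr']
        · exact hc.1
        · exact R.rel_refl _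
      · have hch : s.choice p R (.proto ε k (.offer j false π)) = false := by simp [choice, hc]
        rw [hch] at hK hK'
        have hr' : Mechanism.result B' = s.pos ε k := result_of_done hK'
        rcases result_of_proto hK with hr | hr <;> rw [hr, hr']
        · exact Pref.rel_of_not_strict hc
        · exact R.rel_refl _
    · by_cases hc : R.strict (s.pos ε (k - 1)) (s.pos ε k)
      · have hch : s.choice p R (.proto ε k (.offer j true π)) = true := by simp [choice, hc]
        rw [hch] at hK hK'
        have hr : Mechanism.result B = s.pos ε (k - 1) := result_of_done hK
        rcases result_of_proto hK' with hr' | hr' <;> rw [hr, hr']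
        · exact R.rel_refl _
        · exact hc.1
      · have hch : s.choice p R (.proto ε k (.offer j true π)) = false := by simp [choice, hc]
        rw [hch] at hK hK'
        have hr' : Mechanism.result B' = s.pos ε (k - 1) := result_of_done hK'
        rcases result_of_proto hK with hr | hr <;> rw [hr, hr']
        · exact R.rel_refl _
        · exact Pref.rel_of_not_strict hc
  · cases hm

end SafeguardedDictatorship

/-! ### The outcome of truthful play -/

theorem ProtoDictatorship.result_eq_or {N Y : Type} (π : ProtoDictatorship N) (R : N → Pref Y)
    (y z : Y) : π.result R y z = y ∨ π.result R y z = z := by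
  induction π with
  | last i => simp only [result]; split_ifs <;> simp
  | offer i b rest ih => cases b <;> simp only [result] <;> split_ifs <;> simp [ih]

namespace SafeguardedDictatorship

variable {N : Type} [Fintype N] {s : SafeguardedDictatorship N} {L : ℤ} {ε : Bool}
  {k y : ℤ} {R : N → Pref ℤ} {p : N → ℤ} {t : State N} {m : Bool → State N}

/-- The state is in accordance with the final outcome `y` when all agents follow their strategies. -/
def State.Heading (s : SafeguardedDictatorship N) (R : N → Pref ℤ) (p : N → ℤ) (y : ℤ) :
    State N → Prop
  | .ask ε k _ => ∀ i π, s.arb ε k = some (i, π) → k ≤ s.dist ε (p i)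
  | .proto ε k π => y = π.result R (s.pos ε (k - 1)) (s.pos ε k)
  | .done z => y = z
  | _ => True

theorem heading_enter : (s.enter ε k).Heading s R p y := by
  apply enter_cases
  · exact fun _ _ _ => trivial
  · intro h i π he
    rw [h] at he
    cases he

omit [Fintype N] in
theorem arbitrate_pos_of_forall (hp : ∀ i, (R i).IsIdeal (p i)) (hk : 0 ≤ k)
    (h : ∀ i π, s.arb ε k = some (i, π) → k ≤ s.dist ε (p i)) :
    s.arbitrate R (s.pos ε k) = s.pos ε k := by
  rcases he : s.arb ε k with _ | ⟨i, π⟩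
  · exact arbitrate_pos_of_none hk he
  · exact (arbitrate_pos_of_arb hp he).2 (h i π he)

open Classical in
-- When somebody stops or calls for arbitration, `Reached` for all agents and the motive of the one
-- who acts are the hypotheses of `isBest_pos`, which identifies the best approved policy.
theorem State.Heading.move (hp : ∀ i, (R i).IsIdeal (p i))
    (hy : ∀ b, (R s.dictator).IsBest (s.approved R) b → y = s.arbitrate R b)
    (hr : ∀ i, t.Reached s i (p i)) (h : t.Heading s R p y) (hm : s.move t = some m) :
    (m (s.choice (p (s.player t)) (R (s.player t)) t)).Heading s R p y := by
  rcases t with _ | _ | ⟨ε, k, j, π⟩ | ⟨ε, k, _ | ⟨j, l⟩⟩ | ⟨ε, k, j | ⟨j, b, π⟩⟩ | z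
  · cases hm
    cases s.choice (p (s.player .start)) (R (s.player .start)) .start
    · trivial
    · exact heading_enter
  · cases hm
    by_cases hc : p s.dictator < s.center
    · rw [show s.choice (p (s.player .right_declined)) (R (s.player .right_declined))
        .right_declined = true by simp [choice, player, hc]]
      exact heading_enter
    · rw [show s.choice (p (s.player .right_declined)) (R (s.player .right_declined))
        .right_declined = false by simp [choice, player, hc]]
      have hle : p s.dictator ≤ s.center := hr s.dictator rfl
      have hd : s.dist true (p s.dictator) = 0 := by simp only [dist, if_true]; omega
      change y = s.center
      rw [← pos_zero (ε := true), hy _ (isBest_pos hp le_rfl hd.ge (fun i hi hb => ?_) (Or.inl hd.le)),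
        arbitrate_pos_of_none le_rfl arb_zero]
      have := hb.nonneg hi
      omega
  · cases hm
    obtain ⟨he, hd, -⟩ := hr s.dictator
    have hspec := arb_spec he
    by_cases hc : s.dist ε (p j) < k
    · rw [show s.choice (p (s.player (.arb ε k j π))) (R (s.player (.arb ε k j π)))
        (.arb ε k j π) = true by simp [choice, player, hc]]
      change y = π.result R _ _
      rw [hy _ (isBest_pos hp hspec.1.le (hd rfl) (fun i hi => (hr i).2.2 hi)
        (Or.inr ⟨j, hspec.2.1, hspec.2.2.1, hc.le⟩)), (arbitrate_pos_of_arb hp he).1 hc]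
    · rw [show s.choice (p (s.player (.arb ε k j π))) (R (s.player (.arb ε k j π)))
        (.arb ε k j π) = false by simp [choice, player, hc]]
      intro i π' he'
      rw [he] at he'
      cases he'
      exact not_lt.1 hc
  · cases hm
    obtain ⟨hk, -, hd, -⟩ := hr s.dictator
    by_cases hc : s.dist ε (p s.dictator) ≤ k
    · rw [show s.choice (p (s.player (.ask ε k []))) (R (s.player (.ask ε k [])))
        (.ask ε k []) = true by simp [choice, player, hc]]
      change y = s.pos ε k
      rw [hy _ (isBest_pos hp hk (hd rfl) (fun i hi => ((hr i).2.2.2 hi).1) (Or.inl hc)), arbitrate_pos_of_forall hp hk h]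
    · rw [show s.choice (p (s.player (.ask ε k []))) (R (s.player (.ask ε k [])))
        (.ask ε k []) = false by simp [choice, player, hc]]
      exact heading_enter
  · cases hm
    obtain ⟨hk, hl, hd, -⟩ := hr s.dictator
    by_cases hc : s.dist ε (p j) ≤ k
    · rw [show s.choice (p (s.player (.ask ε k (j :: l)))) (R (s.player (.ask ε k (j :: l))))
        (.ask ε k (j :: l)) = true by simp [choice, player, hc]]
      change y = s.pos ε k
      obtain ⟨h1, h2⟩ := hl j List.mem_cons_self
      rw [hy _ (isBest_pos hp hk (hd rfl) (fun i hi => ((hr i).2.2.2 hi).1)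
        (Or.inr ⟨j, h1, h2, hc⟩)), arbitrate_pos_of_forall hp hk h]
    · rw [show s.choice (p (s.player (.ask ε k (j :: l)))) (R (s.player (.ask ε k (j :: l))))
        (.ask ε k (j :: l)) = false by simp [choice, player, hc]]
      exact h
  · cases hm
    replace h : y = ProtoDictatorship.result R _ _ (.last j) := h
    simp only [ProtoDictatorship.result] at h
    by_cases hc : (R j).strict (s.pos ε (k - 1)) (s.pos ε k)
    · rw [if_pos hc] at h
      rwa [show s.choice (p (s.player (.proto ε k (.last j)))) (R (s.player (.proto ε k (.last j))))
        (.proto ε k (.last j)) = true by simp [choice, player, hc]]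
    · rw [if_neg hc] at h
      rwa [show s.choice (p (s.player (.proto ε k (.last j)))) (R (s.player (.proto ε k (.last j))))
        (.proto ε k (.last j)) = false by simp [choice, player, hc]]
  · cases hm
    replace h : y = ProtoDictatorship.result R _ _ (.offer j b π) := h
    have hact : ∀ (c : Prop) [Decidable c], (s.choice (p j) (R j) (.proto ε k (.offer j b π)) = true ↔ c) →
        (y = if c then (if b then s.pos ε (k - 1) else s.pos ε k) else
          π.result R (s.pos ε (k - 1)) (s.pos ε k)) →
        State.Heading s R p y (if s.choice (p j) (R j) (.proto ε k (.offer j b π)) then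
          .done (if b then s.pos ε (k - 1) else s.pos ε k) else .proto ε k π) := by
      intro c _ hc hy'
      by_cases hc' : c
      · rw [if_pos hc'] at hy'
        rwa [if_pos (hc.2 hc')]
      · rw [if_neg hc'] at hy'
        rwa [if_neg (hc.not.2 hc')]
    cases b
    · exact hact ((R j).strict (s.pos ε k) (s.pos ε (k - 1))) (by simp [choice])
        (by simpa [ProtoDictatorship.result] using h)
    · exact hact ((R j).strict (s.pos ε (k - 1)) (s.pos ε k)) (by simp [choice])
        (by simpa [ProtoDictatorship.result] using h)
  · cases hm

/-- The dictator's own strategy bounds the play, so it ends and the limit outcome is irrelevant;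
`Heading` identifies the final state. -/
theorem result_of_choice (hp : ∀ i, (R i).IsIdeal (p i))
    (hy : ∀ b, (R s.dictator).IsBest (s.approved R) b → y = s.arbitrate R b) :
    Mechanism.result (fun i => (s.automaton L).behavior i (s.choice (p i) (R i))) = y := by
  set B : ∀ i, (s.automaton L).toMechanism.Behavior i :=
    fun i => (s.automaton L).behavior i (s.choice (p i) (R i)) with hB
  have hnext : ∀ {h : List Bool} {t : State N}, (s.automaton L).run h = some t →
      Mechanism.next B h = s.choice (p (s.player t)) (R (s.player t)) t :=
    fun {_ t} ht => Automaton.next_eq (i := s.player t) rfl ht rfl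
  have hstart : (s.automaton L).run (Mechanism.play B 0) = some .start := rfl
  -- The first move is treated separately, because `Within` needs to know the side.
  have hfirst := Automaton.run_play_succ hstart (m := fun a =>
    if a then s.enter true 0 else .right_declined) rfl
  rw [hnext hstart] at hfirst
  have hreach := fun i => State.Reached.move (t := State.start) (R := R i) (s := s) (i := i)
    (p := p i) trivial rfl (a := s.choice (p (s.player .start)) (R (s.player .start)) .start)
    (by rintro rfl; rfl)
  have hhead := State.Heading.move (s := s) (t := .start) hp hy (fun _ => trivial) trivial rfl
  obtain ⟨ε, hw⟩ : ∃ ε, State.Within s ε s.dictator 0 (s.dist ε (p s.dictator))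
      (if s.choice (p (s.player .start)) (R (s.player .start)) .start then s.enter true 0
        else .right_declined) := by
    by_cases hc : s.center < p s.dictator
    · rw [if_pos (by simp [choice, player, hc])]
      exact ⟨true, (State.Within.enter le_rfl (by simp only [dist, if_true]; omega)
        (fun _ => arb_zero) fun h => absurd rfl h).1⟩
    · rw [if_neg (by simp [choice, player, hc])]
      exact ⟨false, rfl, rfl, le_rfl, by simp only [dist, Bool.false_eq_true, if_false]; omega⟩
  obtain ⟨t, hQ, hm, hr⟩ := Automaton.result_of_rank
    (Q := fun t => (t.Within s ε s.dictator 0 (s.dist ε (p s.dictator)) ∧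
      ∀ i, t.Reached s i (p i)) ∧ t.Heading s R p y)
    (fun h t m ht hm ⟨⟨h1, h2⟩, h3⟩ => by
      rw [hnext ht]
      exact ⟨⟨(h1.move (R := R s.dictator) rfl hm (by rintro h; rw [h])).1,
        fun i => (h2 i).move (R := R i) hm (by rintro rfl; rfl)⟩, h3.move hp hy h2 hm⟩)
    hfirst ⟨⟨hw, hreach⟩, hhead⟩ (s.rank (s.dist ε (p s.dictator)))
    fun h t m ht hm ⟨⟨h1, h2⟩, h3⟩ => by
      rw [hnext ht]
      exact (h1.move (R := R s.dictator) rfl hm (by rintro h; rw [h])).2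
  obtain ⟨z, rfl⟩ := eq_done_of_move_eq_none hm
  have hz : y = z := hQ.2
  rw [hz]
  exact hr

/-- Dictatorships with safeguards are implementable in obviously dominant strategies. -/
theorem Represents.ospImplementable {D : Set ℤ} {f : SCF N (singlePeaked D)}
    (hf : s.Represents f) : OSPImplementable f := by
  obtain ⟨L, hL, hfar⟩ := s.exists_far
  have hex : ∀ R : singlePeaked D, ∃ p, (R : Pref ℤ).IsIdeal p := fun R => R.2.imp fun _ h => h.2
  choose p hp using hex
  refine (s.automaton L).ospImplementable (fun R => s.choice (p R) R)
    (fun i R => State.Reached s i (p R)) (fun _ _ => trivial) ?_ ?_ ?_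
  · exact fun i R t m a hm h ha => h.move hm ha
  · exact fun i R t m hm h hi B B' K K' hB hK hK' =>
      rel_result_of_deviation hL hfar (hp R) hm h hi hB hK hK'
  · intro R
    refine result_of_choice (R := fun i => (R i : Pref ℤ)) (p := fun i => p (R i))
      (fun i => hp (R i)) fun b hb => ?_
    obtain ⟨b', hb', hfR⟩ := hf R
    rw [isBest_approved_unique (fun i => hp (R i)) hb hb', hfR]

omit [Fintype N] in
/-- The outcome lies between two ideal points. -/
theorem Represents.between {D : Set ℤ} {f : SCF N (singlePeaked D)} (hf : s.Represents f)
    {R : N → singlePeaked D} {p : N → ℤ} (hp : ∀ i, (R i : Pref ℤ).IsIdeal (p i)) :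
    ∃ i j, p i ≤ f R ∧ f R ≤ p j := by
  classical
  obtain ⟨b, hb, hfR⟩ := hf R
  obtain ⟨ε, hε⟩ : ∃ ε, 0 ≤ s.dist ε (p s.dictator) := by
    rcases le_total s.center (p s.dictator) with h | h
    · exact ⟨true, by simp only [dist, if_true]; omega⟩
    · exact ⟨false, by simp only [dist, Bool.false_eq_true, if_false]; omega⟩
  suffices h : ∃ i j k, s.dist ε (p i) ≤ k ∧ k ≤ s.dist ε (p j) ∧ f R = s.pos ε k by
    obtain ⟨i, j, k, h1, h2, h3⟩ := h
    cases ε <;> simp only [dist, pos, Bool.false_eq_true, if_true, if_false] at h1 h2 h3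
    · exact ⟨j, i, by omega, by omega⟩
    · exact ⟨i, j, by omega, by omega⟩
  -- This is the distance at which truthful play stops; uniqueness of the best approved policy
  -- identifies it with `b`.
  obtain ⟨k, ⟨hk, hkd, hkb⟩, hmax⟩ := Int.exists_greatest_of_bdd
    (P := fun k => 0 ≤ k ∧ k ≤ s.dist ε (p s.dictator) ∧
      ∀ i, i ≠ s.dictator → s.Bound ε i (k - 1) → k ≤ s.dist ε (p i))
    ⟨_, fun _ h => h.2.1⟩
    ⟨0, le_rfl, hε, fun i hi h => by have := h.nonneg hi; omega⟩
  have hlast : s.dist ε (p s.dictator) ≤ k ∨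
      ∃ i, i ≠ s.dictator ∧ s.Bound ε i k ∧ s.dist ε (p i) ≤ k := by
    by_contra! h
    have := hmax (k + 1) ⟨by omega, by omega, fun i hi hb => h.2 i hi (by simpa using hb)⟩
    omega
  rw [isBest_approved_unique hp hb (isBest_pos hp hk hkd hkb hlast)] at hfR
  obtain ⟨i₀, hi₀⟩ : ∃ i, s.dist ε (p i) ≤ k :=
    hlast.elim (fun h => ⟨_, h⟩) fun ⟨i, _, _, h⟩ => ⟨i, h⟩
  rcases he : s.arb ε k with _ | ⟨i, π⟩
  · rw [arbitrate_pos_of_none hk he] at hfR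
    exact ⟨i₀, s.dictator, k, hi₀, hkd, hfR⟩
  · rcases lt_or_ge (s.dist ε (p i)) k with hlt | hge
    · rw [(arbitrate_pos_of_arb hp he).1 hlt] at hfR
      rcases π.result_eq_or (fun i => (R i : Pref ℤ)) (s.pos ε (k - 1)) (s.pos ε k) with h | h <;>
        rw [h] at hfR
      -- The arbitrator's ideal distance is below `k`, hence at most `k - 1`.
      · exact ⟨i, s.dictator, k - 1, by omega, by omega, hfR⟩
      · exact ⟨i₀, s.dictator, k, hi₀, hkd, hfR⟩
    · rw [(arbitrate_pos_of_arb hp he).2 hge] at hfR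
      exact ⟨i₀, s.dictator, k, hi₀, hkd, hfR⟩

end SafeguardedDictatorship

/-! ### Medians and order statistics -/

section Quantiles

variable {N : Type} [Fintype N]

omit [Fintype N] in
-- If a single dissenter never matters, no agent has the power over two preferences that an obvious
-- pair requires.
theorem not_ospImplementable_of_two_ideals [Nonempty N] {D : Set ℤ} (hD : D.Nontrivial)
    {f : SCF N (singlePeaked D)}
    (h₁ : ∀ (x y : ℤ) (p : N → ℤ) (Q : N → singlePeaked D) (i : N), x < y →
      (∀ j, (Q j : Pref ℤ).IsIdeal (p j)) → p i = x → (∀ j, j ≠ i → p j = y) → f Q = y)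
    (h₂ : ∀ (x y : ℤ) (p : N → ℤ) (Q : N → singlePeaked D) (i : N), x < y →
      (∀ j, (Q j : Pref ℤ).IsIdeal (p j)) → p i = y → (∀ j, j ≠ i → p j = x) → f Q = x) :
    ¬ OSPImplementable f := by
  classical
  obtain ⟨x, hx, y, hy, hxy⟩ := hD.exists_lt
  refine not_ospImplementable_of_no_binary_power hxy.ne
    ⟨_, x, hx, Pref.isIdeal_rightLexi x⟩ ⟨_, y, hy, Pref.isIdeal_rightLexi y⟩
    (Pref.isIdeal_rightLexi x) (Pref.isIdeal_rightLexi y) (fun Q i hi hj => ?_) fun Q i hi hj => ?_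
  · refine h₁ x y (fun j => if j = i then x else y) Q i hxy (fun j => ?_) (if_pos rfl)
      fun j hj => if_neg hj
    by_cases h : j = i
    · subst h; rw [hi, if_pos rfl]; exact Pref.isIdeal_rightLexi x
    · rw [hj j h, if_neg h]; exact Pref.isIdeal_rightLexi y
  · refine h₂ x y (fun j => if j = i then y else x) Q i hxy (fun j => ?_) (if_pos rfl)
      fun j hj => if_neg hj
    by_cases h : j = i
    · subst h; rw [hi, if_pos rfl]; exact Pref.isIdeal_rightLexi y
    · rw [hj j h, if_neg h]; exact Pref.isIdeal_rightLexi x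

theorem card_le_card_filter_add_one (P : N → Prop) [DecidablePred P] (i : N)
    (h : ∀ j, j ≠ i → P j) : Fintype.card N ≤ (Finset.univ.filter P).card + 1 := by
  classical
  rw [← Finset.card_univ]
  refine (Finset.card_le_card (t := insert i (Finset.univ.filter P)) fun j _ => ?_).trans
    (Finset.card_insert_le _ _)
  by_cases hj : j = i
  · simp [hj]
  · simp [h j hj]

theorem IsMedianRule.not_ospImplementable {D : Set ℤ} (hD : D.Nontrivial)
    (hN : 3 ≤ Fintype.card N) {f : SCF N (singlePeaked D)} (hf : IsMedianRule f) :
    ¬ OSPImplementable f := by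
  have : Nonempty N := Fintype.card_pos_iff.1 (by omega)
  refine not_ospImplementable_of_two_ideals hD (fun x y p Q i hxy hp hi hj => ?_)
    fun x y p Q i hxy hp hi hj => ?_ <;> obtain ⟨h1, h2⟩ := hf Q p hp <;> by_contra hne <;>
    rcases lt_or_gt_of_ne hne with hlt | hlt
  · have := card_le_card_filter_add_one (fun j => f Q < p j) i fun j h => by rw [hj j h]; exact hlt
    omega
  · have := card_le_card_filter_add_one (fun j => p j < f Q) i fun j h => by rw [hj j h]; exact hlt
    omega
  · have := card_le_card_filter_add_one (fun j => f Q < p j) i fun j h => by rw [hj j h]; exact hlt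
    omega
  · have := card_le_card_filter_add_one (fun j => p j < f Q) i fun j h => by rw [hj j h]; exact hlt
    omega

theorem IsQuantileRule.extreme_of_ospImplementable [Nonempty N] {D : Set ℤ} (hD : D.Nontrivial)
    {k : ℕ} (hk : 1 ≤ k) (hkN : k ≤ Fintype.card N) {f : SCF N (singlePeaked D)}
    (hf : IsQuantileRule k f) (ho : OSPImplementable f) : k = 1 ∨ k = Fintype.card N := by
  by_contra! hne
  refine not_ospImplementable_of_two_ideals hD (fun x y p Q i hxy hp hi hj => ?_)
    (fun x y p Q i hxy hp hi hj => ?_) ho <;> obtain ⟨h1, h2⟩ := hf Q p hp <;> by_contra hfQ <;>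
    rcases lt_or_gt_of_ne hfQ with hlt | hlt
  · have : (Finset.univ.filter fun j => p j ≤ f Q).card ≤ 1 := by
      refine (Finset.card_le_card (t := {i}) fun j hj' => ?_).trans (Finset.card_singleton i).le
      by_contra hji
      rw [Finset.mem_singleton] at hji
      have := (Finset.mem_filter.1 hj').2
      rw [hj j hji] at this
      omega
    omega
  · have := card_le_card_filter_add_one (fun j => p j < f Q) i fun j h => by rw [hj j h]; exact hlt
    omega
  · have : (Finset.univ.filter fun j => p j ≤ f Q).card = 0 := by
      rw [Finset.card_eq_zero, Finset.filter_eq_empty_iff]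
      intro j _
      by_cases h : j = i
      · rw [h, hi]; omega
      · rw [hj j h]; omega
    omega
  · have := card_le_card_filter_add_one (fun j => p j < f Q) i fun j h => by rw [hj j h]; exact hlt
    omega

/-- With the center and all right bounds at a lower bound `c` of `D`, everyone can stop the move to
the right at her ideal point. Whoever is dictator, the rightmost policy she can reach is the
minimum. -/
theorem IsQuantileRule.ospImplementable_min [Nonempty N] {D : Set ℤ} (hD : BddBelow D)
    {f : SCF N (singlePeaked D)} (hf : IsQuantileRule 1 f) : OSPImplementable f := by
  obtain ⟨c, hc⟩ := hD
  let s : SafeguardedDictatorship N :=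
    { dictator := Classical.arbitrary N
      left := fun _ => ⊥
      right := fun _ => (c : WithTop ℤ)
      center := c
      left_le := fun _ _ => bot_le
      le_right := fun _ _ => le_rfl
      arbRight := fun _ => none
      arbLeft := fun _ => none
      arbRight_spec := fun _ _ _ h => by cases h
      arbLeft_spec := fun _ _ _ h => by cases h }
  refine SafeguardedDictatorship.Represents.ospImplementable (s := s) fun R => ⟨f R, ?_,
    (s.arbitrate_of_none rfl rfl).symm⟩
  have hex : ∀ i, ∃ p, p ∈ D ∧ (R i : Pref ℤ).IsIdeal p := fun i => (R i).2
  choose p hpD hp using hex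
  obtain ⟨h1, h2⟩ := hf R p hp
  have hle : ∀ i, f R ≤ p i := by
    intro i
    by_contra! hlt
    have := Finset.card_pos.2 ⟨i, Finset.mem_filter (p := fun i => p i < f R).2 ⟨Finset.mem_univ i, hlt⟩⟩
    omega
  obtain ⟨i, hi⟩ := Finset.card_pos.1 h2
  have hi := (Finset.mem_filter.1 hi).2
  refine s.isBest_of_right hp ((s.mem_approved_iff hp).2 fun j _ => ⟨fun k hk => ?_, fun k hk => ?_⟩)
    (hle _) ?_
  · exact absurd hk WithBot.bot_ne_coe
  · exact le_max_of_le_right (hle j)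
  · by_cases hd : i = s.dictator
    · exact Or.inl (le_antisymm (hle _) (hd ▸ hi))
    · exact Or.inr ⟨i, hd, c, rfl, max_le ((hc (hpD i)).trans hi) hi⟩

theorem IsQuantileRule.ospImplementable_max [Nonempty N] {D : Set ℤ} (hD : BddAbove D)
    {f : SCF N (singlePeaked D)} (hf : IsQuantileRule (Fintype.card N) f) : OSPImplementable f := by
  obtain ⟨c, hc⟩ := hD
  let s : SafeguardedDictatorship N :=
    { dictator := Classical.arbitrary N
      left := fun _ => (c : WithBot ℤ)
      right := fun _ => ⊤
      center := c
      left_le := fun _ _ => le_rfl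
      le_right := fun _ _ => le_top
      arbRight := fun _ => none
      arbLeft := fun _ => none
      arbRight_spec := fun _ _ _ h => by cases h
      arbLeft_spec := fun _ _ _ h => by cases h }
  refine SafeguardedDictatorship.Represents.ospImplementable (s := s) fun R => ⟨f R, ?_,
    (s.arbitrate_of_none rfl rfl).symm⟩
  have hex : ∀ i, ∃ p, p ∈ D ∧ (R i : Pref ℤ).IsIdeal p := fun i => (R i).2
  choose p hpD hp using hex
  obtain ⟨h1, h2⟩ := hf R p hp
  have hge : ∀ i, p i ≤ f R := by
    have := (Finset.card_eq_iff_eq_univ _).1 (le_antisymm (Finset.card_le_univ _) h2)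
    exact fun i => (Finset.filter_eq_self.1 this) i (Finset.mem_univ i)
  obtain ⟨i, hi⟩ : ∃ i, f R ≤ p i := by
    by_contra! hlt
    rw [Finset.filter_true_of_mem fun i _ => hlt i, Finset.card_univ] at h1
    exact lt_irrefl _ h1
  refine s.isBest_of_left hp ((s.mem_approved_iff hp).2 fun j _ => ⟨fun k hk => ?_, fun k hk => ?_⟩)
    (hge _) ?_
  · exact min_le_of_right_le (hge j)
  · exact absurd hk WithTop.top_ne_coe
  · by_cases hd : i = s.dictator
    · exact Or.inl (le_antisymm (hd ▸ hi) (hge _))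
    · exact Or.inr ⟨i, hd, c, rfl, le_min (hi.trans (hc (hpD i))) hi⟩

end Quantiles

/-! ### Efficiency, unanimity and the theorem -/

/-- An agent with ideal point at most the outcome accepts nothing further right, and one with ideal
point at least the outcome nothing further left; both kinds exist. -/
theorem IsDictatorshipWithSafeguards.paretoOptimal {N : Type} {D : Set ℤ}
    {f : SCF N (singlePeaked D)} (hf : IsDictatorshipWithSafeguards f) : ParetoOptimal f := by
  obtain ⟨s, hs⟩ := hf
  rintro R ⟨y, hy, i, hi⟩
  have hex : ∀ i, ∃ p, (R i : Pref ℤ).IsIdeal p := fun i => (R i).2.imp fun _ h => h.2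
  choose p hp using hex
  obtain ⟨j, k, hj, hk⟩ := hs.between hp
  have h1 := (hp j).le_of_rel hj (hy j)
  have h2 := (hp k).ge_of_rel hk (hy k)
  rw [le_antisymm h1 h2] at hi
  exact hi.2 hi.1

theorem IsDictatorshipWithSafeguards.unanimous {N : Type} {D : Set ℤ}
    {f : SCF N (singlePeaked D)} (hf : IsDictatorshipWithSafeguards f) : Unanimous f := by
  obtain ⟨s, hs⟩ := hf
  intro R p hp
  obtain ⟨j, k, hj, hk⟩ := hs.between hp
  exact le_antisymm hk hj

theorem theorem3 (N : Type) [Fintype N] [Nonempty N] :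
    (∀ f : SCF N (singlePeaked Set.univ),
      ((Unanimous f ∧ OSPImplementable f) ↔ IsDictatorshipWithSafeguards f) ∧
      (IsDictatorshipWithSafeguards f → ParetoOptimal f)) ∧
    (∀ D : Set ℤ,
      (D.Nontrivial → 3 ≤ Fintype.card N → ∀ f : SCF N (singlePeaked D),
        IsMedianRule f → ¬ OSPImplementable f) ∧
      (D.Nontrivial → ∀ k : ℕ, 1 ≤ k → k ≤ Fintype.card N → ∀ f : SCF N (singlePeaked D),
        IsQuantileRule k f → OSPImplementable f → k = 1 ∨ k = Fintype.card N) ∧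
      (BddBelow D → ∀ f : SCF N (singlePeaked D), IsQuantileRule 1 f → OSPImplementable f) ∧
      (BddAbove D → ∀ f : SCF N (singlePeaked D),
        IsQuantileRule (Fintype.card N) f → OSPImplementable f)) := by
  refine ⟨fun f => ⟨⟨fun h => isDictatorshipWithSafeguards_of_ospImplementable h.1 h.2,
    fun h => ⟨h.unanimous, ?_⟩⟩, fun h => h.paretoOptimal⟩,
    fun D => ⟨fun hD hN f hf => hf.not_ospImplementable hD hN,
      fun hD k hk hkN f hf => hf.extreme_of_ospImplementable hD hk hkN,
      fun hD f hf => hf.ospImplementable_min hD, fun hD f hf => hf.ospImplementable_max hD⟩⟩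
  obtain ⟨s, hs⟩ := h
  exact hs.ospImplementable
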